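/- **Setting.** Let $1\le r\le H$ and $N\ge 1$ be integers. A server with $N$ files of $B$ i.i.d. uniform bits is connected by error-free links to $H$ relays. There are $K=\binom{H}{r}$ users, one for each $r$-subset of relays; a user is connected by error-free links to the $r$ relays in its subset. Before the demands are known, each relay caches $M^{\rm relay}B$ bits and each user caches $M^{\rm user}B$ bits. Then user $k$ requests file $d_k$; knowing $d=(d_k)_k$, the server sends a message to each relay, each relay sends to each of its users a message computed from its cache and from what it received, and each user must recover its file from its cache and the $r$ messages it received, with error probability tending to $0$ as $B\to\infty$. $R^{s\to r}$ and $R^{r\to u}$ are the maximal lengths, divided by $B$, of a message from the server to a relay and from a relay to a user, for worst-case demands; $(M^{\rm relay},M^{\rm user},R^{s\to r},R^{r\to u})$ is achievable if these memories suffice for loads at most $R^{s\to r}+\varepsilon$, $R^{r\to u}+\varepsilon$ for every $\varepsilon>0$ and all large $B$. **Notation.** $\binom{x}{y}=0$ if $x<0$, $y<0$ or $x<y$; $K_i=\binom{H-i}{r-i}$; $$S_1(g)=\sum_{a=1}^{r}(-1)^{a-1}\binom ra\binom{K_a}{g-1},\quad S_2(g)=\sum_{a=1}^{r}(-1)^{a-1}\binom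 ra\binom{K_a-1}{g-2},\quad y^*(g)=\max\{y\in[1:r]:K_y\ge g-1\}.$$ For a set $W$ of users, $R_W$ is the set of relays connected to all users in $W$, and $Z_g$ is the collection of the sets $W$ of $g-1$ users with $R_W\ne\emptyset$. **The scheme with gain $g$.** Each file $i$ is cut into $S_1(g)$ equal pieces, which are encoded by a $(|Z_g|,S_1(g))$ MDS code into symbols $f_{i,W}$, $W\in Z_g$, of $L=B/S_1(g)$ bits. Each $f_{i,W}$ is partitioned into parts $f_{i,W,h}$ ($h\in R_W$) of $c$ bits, with $f_{i,W,h}$ cached by relay $h$, and a remainder $f'_{i,W}$, cached by every user in $W$. In the delivery, each relay $h$ sends to each of its users $k$: (a) all $f_{d_k,W,h}$; (b) $f_{d_{k'},W,h}$ for all $W\in Z_g$ with $k\in W$, $h\in R_W$, $|R_W|>1$, and all users $k'$ not connected to $h$ with $R_{W\cup\{k'\}}\neq\emptyset$; (c) the messages $V^h_J$ with $k\in J$. Here, for each set $J$ of $g$ users of relay $h$, the server sends $V^h_J=\bigoplus_{k\in J}G_{k,J\setminus\{k\},h}$ to relay $h$, where the bits of $f_{d_k,J\setminus\{k\}}$ that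 are not in any $f_{d_k,J\setminus\{k\},h'}$, $h'\in R_J$, are divided into $|R_J|$ equal parts $G_{k,J\setminus\{k\},h}$, $h\in R_J$. **Claim.** For the following three groups of points, the scheme indicated exists for arbitrarily large $B$ (for every multiple of some suitable file length), every user recovers its file without error, and the memories and loads are exactly the ones stated, for all demands. 1. For $g\in[1:K_1]$, the scheme with gain $g$ and $c=0$: $$M^{\rm relay}=0,\quad M^{\rm user}=\frac{N S_2(g)}{S_1(g)},\quad R^{s\to r}=\frac{K(1-M^{\rm user}/N)}{Hg},\quad R^{r\to u}=\frac{1-M^{\rm user}/N}{r}.$$ 2. For $g\in[2:K_2+1]$, the scheme with gain $g$ and $c=L/y^*(g)$: $$M^{\rm relay}=\frac{N\binom{K_1}{g-1}}{y^*(g)S_1(g)},\qquad M^{\rm user}=\frac{N S_2(g)}{S_1(g)}-\frac{N\binom{K_1-1}{g-2}r}{y^*(g)S_1(g)},$$ $$R^{s\to r}=\frac{K\max\{1-(rM^{\rm relay}+M^{\rm user})/N,\,0\}}{Hg},$$ $$R^{r\to u}=\frac{1-M^{\rm user}/N}{r}+\frac{\sum_{b=2}^{r}(-1)^b\binom{r-1}{b-1}\binom{K_b-1}{g-2}(K_{b-1}-K_b)}{y^*(g)S_1(g)}.$$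 3. $(M^{\rm relay},M^{\rm user},R^{s\to r},R^{r\to u})=(N/r,0,0,1/r)$ and $(N/r,N,0,0)$: each file is cut into $r$ pieces, encoded by an $(H,r)$ MDS code, and relay $h$ caches the $h$-th symbol of every file; the server sends nothing. In the first case users cache nothing and relay $h$ sends to user $k$ the $h$-th symbol of file $d_k$; in the second case users cache all files and nothing is sent. Moreover, by memory sharing, every point on or (coordinatewise) above the lower convex envelope of these points, that is, every $(M^{\rm relay},M^{\rm user},R^{s\to r},R^{r\to u})$ that is coordinatewise at least some point of their convex hull, is achievable. -/

import Mathlib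

namespace CombNet

/-! # Combination networks with cache-aided relays and users -/

/-- The users: every user is connected to its own set of `r` of the `H` relays. -/
abbrev User (H r : ℕ) : Type := {s : Finset (Fin H) // s.card = r}

/-- `R_W`: the relays connected to all the users in `W`. -/
def commonRelays {H r : ℕ} (W : Finset (User H r)) : Finset (Fin H) :=
  Finset.univ.filter fun h => ∀ k ∈ W, h ∈ k.1

/-- A library of `N` files of `B` bits each. -/
abbrev Files (N B : ℕ) : Type := Fin N → Fin B → ZMod 2

/-- A demand vector: user `k` requests file `d k`. -/
abbrev Demand (H r N : ℕ) : Type := User H r → Fin N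

/-- A placement and a delivery for `N` files of `B` bits. Every cache content and every message is
a string of bits, indexed by a finite type whose cardinality is the number of bits. The link from
relay `h` to user `k` exists exactly when `h ∈ k.1`. The demands are known to all nodes, and the
server knows the library. -/
structure Code (H r N B : ℕ) where
  RelayIdx : Fin H → Type
  UserIdx : User H r → Type
  TxIdx : Demand H r N → Fin H → Type
  FwdIdx : Demand H r N → (k : User H r) → k.1 → Type
  finiteRelay : ∀ h, Finite (RelayIdx h)
  finiteUser : ∀ k, Finite (UserIdx k)
  finiteTx : ∀ d h, Finite (TxIdx d h)
  finiteFwd : ∀ d k h, Finite (FwdIdx d k h)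
  /-- content of the cache of relay `h` -/
  relayCache : Files N B → (h : Fin H) → RelayIdx h → ZMod 2
  /-- content of the cache of user `k` -/
  userCache : Files N B → (k : User H r) → UserIdx k → ZMod 2
  /-- message from the server to relay `h` -/
  tx : (d : Demand H r N) → Files N B → (h : Fin H) → TxIdx d h → ZMod 2
  /-- message from relay `h` to user `k`, computed from the cache of the relay and from what the
  relay received from the server -/
  fwd : (d : Demand H r N) → (k : User H r) → (h : k.1) →
    (RelayIdx h → ZMod 2) → (TxIdx d h → ZMod 2) → FwdIdx d k h → ZMod 2

namespace Code

variable {H r N B : ℕ}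

/-- The shape of what user `k` holds at the end: its cache and the messages of its relays. -/
abbrev View (C : Code H r N B) (d : Demand H r N) (k : User H r) : Type :=
  (C.UserIdx k → ZMod 2) × ((h : k.1) → C.FwdIdx d k h → ZMod 2)

/-- What user `k` holds at the end of the delivery phase. -/
def view (C : Code H r N B) (d : Demand H r N) (F : Files N B) (k : User H r) : C.View d k :=
  (C.userCache F k, fun h => C.fwd d k h (C.relayCache F h) (C.tx d F h))

/-- For i.i.d. uniform file bits, with probability at least `1 - ε` every user recovers the file
that it requests. For `ε = 0` this is recovery for every library. -/
def Recovers (C : Code H r N B) (d : Demand H r N) (ε : ℝ) : Prop :=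
  ∃ dec : (k : User H r) → C.View d k → (Fin B → ZMod 2),
    ({F : Files N B | ∃ k, dec k (C.view d F k) ≠ F (d k)}.ncard : ℝ) ≤
      ε * (Nat.card (Files N B) : ℝ)

/-- `C` uses exactly the memories `p.1` (relays) and `p.2.1` (users), puts exactly the load
`p.2.2.1` on every link from the server to a relay and `p.2.2.2` on every link from a relay to a
user, whatever the demands are, and every user recovers its file without error. Memories and loads
are measured in files, that is, in units of `B` bits. -/
def Attains (C : Code H r N B) (p : ℝ × ℝ × ℝ × ℝ) : Prop :=
  (∀ h, (Nat.card (C.RelayIdx h) : ℝ) = p.1 * B) ∧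
  (∀ k, (Nat.card (C.UserIdx k) : ℝ) = p.2.1 * B) ∧
  ∀ d : Demand H r N,
    (∀ h, (Nat.card (C.TxIdx d h) : ℝ) = p.2.2.1 * B) ∧
    (∀ k h, (Nat.card (C.FwdIdx d k h) : ℝ) = p.2.2.2 * B) ∧
    C.Recovers d 0

end Code

/-- `(Mrelay, Muser, Rsr, Rru)` is achievable in the network with `N` files: with caches of at most
`Mrelay * B` and `Muser * B` bits, for worst-case demands the maximal link loads come
arbitrarily close to `Rsr` and `Rru` (or lower) and the error probability to `0` as `B → ∞`. -/
def Achievable (H r N : ℕ) (p : ℝ × ℝ × ℝ × ℝ) : Prop :=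
  ∀ ε : ℝ, 0 < ε → ∃ B₀ : ℕ, ∀ B : ℕ, B₀ ≤ B → ∃ C : Code H r N B,
    (∀ h, (Nat.card (C.RelayIdx h) : ℝ) ≤ p.1 * B) ∧
    (∀ k, (Nat.card (C.UserIdx k) : ℝ) ≤ p.2.1 * B) ∧
    ∀ d : Demand H r N,
      (∀ h, (Nat.card (C.TxIdx d h) : ℝ) ≤ (p.2.2.1 + ε) * B) ∧
      (∀ k h, (Nat.card (C.FwdIdx d k h) : ℝ) ≤ (p.2.2.2 + ε) * B) ∧
      C.Recovers d ε

/-! ## Parameters -/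

/-- Binomial coefficient, with the convention that it is `0` if `x < 0` or `y < 0` or `x < y`. -/
def binom (x y : ℤ) : ℤ := if 0 ≤ x ∧ 0 ≤ y then (x.toNat.choose y.toNat : ℤ) else 0

/-- `K_i = binom (H - i) (r - i)`, the number of users connected to `i` given relays. -/
def numUsers (H r i : ℕ) : ℤ := binom ((H : ℤ) - i) ((r : ℤ) - i)

/-- `S₁(g)` -/
def S₁ (H r g : ℕ) : ℤ :=
  ∑ a ∈ Finset.Icc 1 r, binom r a * binom (numUsers H r a) ((g : ℤ) - 1) * (-1) ^ (a - 1)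

/-- `S₂(g)` -/
def S₂ (H r g : ℕ) : ℤ :=
  ∑ a ∈ Finset.Icc 1 r, binom r a * binom (numUsers H r a - 1) ((g : ℤ) - 2) * (-1) ^ (a - 1)

/-- `y* = max {y ∈ [1 : r] : K_y ≥ g - 1}` -/
def yStar (H r g : ℕ) : ℕ :=
  ((Finset.Icc 1 r).filter fun y => (g : ℤ) - 1 ≤ numUsers H r y).sup id

/-- The corner point for end-user caches with gain `g`. -/
noncomputable def endUserPoint (H r N g : ℕ) : ℝ × ℝ × ℝ × ℝ :=
  let K : ℝ := numUsers H r 0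
  let Mu : ℝ := N * S₂ H r g / S₁ H r g
  (0, Mu, K * (1 - Mu / N) / (H * g), (1 - Mu / N) / r)

/-- `M^relay` at the corner point with gain `g` for cache-aided relays and users. -/
noncomputable def relayMem (H r N g : ℕ) : ℝ :=
  N * binom (numUsers H r 1) ((g : ℤ) - 1) / (yStar H r g * S₁ H r g)

/-- `M^user` at the corner point with gain `g` for cache-aided relays and users. -/
noncomputable def userMem (H r N g : ℕ) : ℝ :=
  N * S₂ H r g / S₁ H r g -
    N * binom (numUsers H r 1 - 1) ((g : ℤ) - 2) * r / (yStar H r g * S₁ H r g)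

/-- The corner point with gain `g` for cache-aided relays and users. -/
noncomputable def relayUserPoint (H r N g : ℕ) : ℝ × ℝ × ℝ × ℝ :=
  let K : ℝ := numUsers H r 0
  (relayMem H r N g, userMem H r N g,
    K * max (1 - (r * relayMem H r N g + userMem H r N g) / N) 0 / (H * g),
    (1 - userMem H r N g / N) / r +
      ((∑ b ∈ Finset.Icc 2 r, binom ((r : ℤ) - 1) ((b : ℤ) - 1) *
          binom (numUsers H r b - 1) ((g : ℤ) - 2) *
          (numUsers H r (b - 1) - numUsers H r b) * (-1) ^ b : ℤ) : ℝ) /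
        (yStar H r g * S₁ H r g))

/-- Relays cache everything that is needed, users cache nothing. -/
noncomputable def relayPoint (r N : ℕ) : ℝ × ℝ × ℝ × ℝ := ((N : ℝ) / r, 0, 0, 1 / (r : ℝ))

/-- Users cache the whole library. -/
noncomputable def fullPoint (r N : ℕ) : ℝ × ℝ × ℝ × ℝ := ((N : ℝ) / r, (N : ℝ), 0, 0)

/-- The three groups of corner points. -/
def cornerPoints (H r N : ℕ) : Set (ℝ × ℝ × ℝ × ℝ) :=
  {p | ∃ g : ℕ, 1 ≤ g ∧ (g : ℤ) ≤ numUsers H r 1 ∧ p = endUserPoint H r N g} ∪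
  {p | ∃ g : ℕ, 2 ≤ g ∧ (g : ℤ) ≤ numUsers H r 2 + 1 ∧ p = relayUserPoint H r N g} ∪
  {relayPoint r N, fullPoint r N}

/-! ## The scheme -/

/-- An `(n, s)` MDS code on symbols of `L` bits, `n` being the size of `ι`: any `s` of the `n`
coded symbols determine the `s` uncoded ones. -/
def IsMDS {ι : Type} {s L : ℕ} (enc : (Fin s → Fin L → ZMod 2) → ι → Fin L → ZMod 2) : Prop :=
  s ≤ Nat.card ι ∧
    ∀ T : Finset ι, T.card = s → Function.Injective fun (m : Fin s → Fin L → ZMod 2) (w : T) => enc m w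

/-- Cut a file of `s * L` bits into `s` consecutive pieces of `L` bits. -/
def pieces {s L : ℕ} (f : Fin (s * L) → ZMod 2) : Fin s → Fin L → ZMod 2 :=
  fun i p => f (finProdFinEquiv (i, p))

/-- `Z_g`: the sets of `g - 1` users that have a common relay. -/
def subfileSets (H r g : ℕ) : Finset (Finset (User H r)) :=
  Finset.univ.filter fun W => W.card + 1 = g ∧ (commonRelays W).Nonempty

/-- For `|J| = g` and `k ∈ J`, the number of bits of each of the `|R_J|` equal parts of the bits of
the symbol indexed by `J \ {k}` that are unknown to user `k` after the first step of the delivery,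
if symbols have `L` bits and each relay in `R_J` caches `c` bits of the symbol. -/
def partLen {H r : ℕ} (L c : ℕ) (J : Finset (User H r)) : ℕ :=
  (L - (commonRelays J).card * c) / (commonRelays J).card

/-- The free choices in the scheme with gain `g`, MDS symbols of `L` bits, and `c` bits per symbol
cached at each relevant relay: the MDS code, and the ways to divide the MDS symbols. -/
structure Design (H r g L c : ℕ) where
  /-- the `(|Z_g|, S₁(g))` MDS code -/
  enc : (Fin (S₁ H r g).toNat → Fin L → ZMod 2) → subfileSets H r g → Fin L → ZMod 2
  isMDS : IsMDS enc
  /-- Division of the symbol `f_{i,W}` for the placement: `owner W p = some h` if bit `p` belongs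
  to `f_{i,W,h}`, and `owner W p = none` if it belongs to `f'_{i,W}`. -/
  owner : Finset (User H r) → Fin L → Option (Fin H)
  owner_mem : ∀ W ∈ subfileSets H r g, ∀ p h, owner W p = some h → h ∈ commonRelays W
  owner_card : ∀ W ∈ subfileSets H r g, ∀ h ∈ commonRelays W,
    (Finset.univ.filter fun p => owner W p = some h).card = c
  /-- Division of `G_{k,W}`, where `W = J \ {k}`, for the delivery: `part J k h j` is the position
  in the symbol of the `j`-th bit of `G_{k,W,h}`. -/
  part : (J : Finset (User H r)) → User H r → Fin H → Fin (partLen L c J) → Fin L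
  part_bijOn : ∀ J : Finset (User H r), ∀ k ∈ J, J.card = g → (commonRelays J).Nonempty →
    Set.BijOn (fun x : Fin H × Fin (partLen L c J) => part J k x.1 x.2)
      {x | x.1 ∈ commonRelays J}
      {p | ∀ h ∈ commonRelays J, owner (J.erase k) p ≠ some h}

namespace Design

variable {H r g L c : ℕ}

/-- Bit `p` of the MDS symbol `f_{i,W}` (`0` if `W ∉ Z_g`). -/
def symbol (D : Design H r g L c) {N : ℕ} (F : Files N ((S₁ H r g).toNat * L)) (i : Fin N)
    (W : Finset (User H r)) (p : Fin L) : ZMod 2 :=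
  if hW : W ∈ subfileSets H r g then D.enc (pieces (F i)) ⟨W, hW⟩ p else 0

/-- The placement and the delivery of the scheme. -/
def code (D : Design H r g L c) (N : ℕ) : Code H r N ((S₁ H r g).toNat * L) where
  -- relay `h` caches `f_{i,W,h}` for all files `i`
  RelayIdx h := {x : Fin N × Finset (User H r) × Fin L //
    x.2.1 ∈ subfileSets H r g ∧ D.owner x.2.1 x.2.2 = some h}
  -- user `k` caches `f'_{i,W}` for all files `i` and all `W` that contain `k`
  UserIdx k := {x : Fin N × Finset (User H r) × Fin L //
    x.2.1 ∈ subfileSets H r g ∧ k ∈ x.2.1 ∧ D.owner x.2.1 x.2.2 = none}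
  -- the server sends to relay `h` one multicast message for each set `J` of `g` of its users
  TxIdx _ h := (J : {J : Finset (User H r) // J.card = g ∧ h ∈ commonRelays J}) ×
    Fin (partLen L c J.1)
  -- relay `h` sends to user `k`: the bits of the requested file of `k` that it caches; the bits
  -- of `f_{d_{k'},W,h}` for `W` containing `k` and for the users `k'` that are not connected to
  -- `h` but have a relay in common with `W`; and the multicast messages for sets containing `k`
  FwdIdx _ k h :=
    {x : Finset (User H r) × Fin L // x.1 ∈ subfileSets H r g ∧ D.owner x.1 x.2 = some h.1} ⊕
    {x : User H r × Finset (User H r) × Fin L //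
      x.2.1 ∈ subfileSets H r g ∧ D.owner x.2.1 x.2.2 = some h.1 ∧ k ∈ x.2.1 ∧
      1 < (commonRelays x.2.1).card ∧ h.1 ∉ x.1.1 ∧ (commonRelays (insert x.1 x.2.1)).Nonempty} ⊕
    ((J : {J : Finset (User H r) // (J.card = g ∧ h.1 ∈ commonRelays J) ∧ k ∈ J}) ×
      Fin (partLen L c J.1))
  finiteRelay _ := inferInstance
  finiteUser _ := inferInstance
  finiteTx _ _ := inferInstance
  finiteFwd _ _ _ := inferInstance
  relayCache F _ x := D.symbol F x.1.1 x.1.2.1 x.1.2.2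
  userCache F _ x := D.symbol F x.1.1 x.1.2.1 x.1.2.2
  -- bitwise XOR over `k ∈ J` of the parts `G_{k,J \ {k},h}`
  tx d F h x := ∑ k ∈ x.1.1, D.symbol F (d k) (x.1.1.erase k) (D.part x.1.1 k h x.2)
  fwd d k _ z x := Sum.elim
    (fun a => z ⟨(d k, a.1), a.2⟩)
    (Sum.elim
      (fun b => z ⟨(d b.1.1, b.1.2), b.2.1, b.2.2.1⟩)
      (fun m => x ⟨⟨m.1.1, m.1.2.1⟩, m.2⟩))

end Design

/-- An `(H, r)` MDS code on symbols of `L` bits. -/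
structure RelayDesign (H r L : ℕ) where
  enc : (Fin r → Fin L → ZMod 2) → Fin H → Fin L → ZMod 2
  isMDS : IsMDS enc

/-- Relay `h` caches the `h`-th MDS symbol of every file and sends the one of the file requested by
user `k` to user `k`; the server sends nothing and users cache nothing. -/
def RelayDesign.code {H r L : ℕ} (D : RelayDesign H r L) (N : ℕ) : Code H r N (r * L) where
  RelayIdx _ := Fin N × Fin L
  UserIdx _ := Empty
  TxIdx _ _ := Empty
  FwdIdx _ _ _ := Fin L
  finiteRelay _ := inferInstance
  finiteUser _ := inferInstance
  finiteTx _ _ := inferInstance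
  finiteFwd _ _ _ := inferInstance
  relayCache F h x := D.enc (pieces (F x.1)) h x.2
  userCache _ _ := Empty.elim
  tx _ _ _ := Empty.elim
  fwd d k _ z _ p := z (d k, p)

/-- As before, but every user caches all the files and nothing is sent. -/
def RelayDesign.fullCode {H r L : ℕ} (D : RelayDesign H r L) (N : ℕ) : Code H r N (r * L) where
  RelayIdx _ := Fin N × Fin L
  UserIdx _ := Fin N × Fin (r * L)
  TxIdx _ _ := Empty
  FwdIdx _ _ _ := Empty
  finiteRelay _ := inferInstance
  finiteUser _ := inferInstance
  finiteTx _ _ := inferInstance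
  finiteFwd _ _ _ := inferInstance
  relayCache F h x := D.enc (pieces (F x.1)) h x.2
  userCache F _ x := F x.1 x.2
  tx _ _ _ := Empty.elim
  fwd _ _ _ _ _ := Empty.elim

end CombNet

/-! Decoding. User `k` needs the symbols indexed by the sets `W` of `g - 1` users such that `W ∪
{k}` has a common relay, that is, such that one of the `r` relays of `k` lies in `R_W`.
Inclusion-exclusion over these relays gives exactly `S₁` such sets (`card_neededSets`), the
dimension of the MDS code, so they determine the file. If `k ∈ W`, every bit is in the cache of `k`
or is sent by a relay of `k` that caches it. If `k ∉ W`, let `J = W ∪ {k}`: bits cached at a relay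
of `R_J` are sent directly, and each other bit occurs in one multicast message for `J`. The
interfering bits there come from symbols indexed by `J \ {k'}`, which contains `k`. Such a bit is in
the cache of `k`, or at a relay outside `R_J`; this relay is then not connected to `k'`, and the
cross messages (b) supply the bit (`Design.recovers`).

Loads. A multicast message for `J` has `L / |R_J| - c` bits. Since permuting relays is a symmetry,
the sum of `1 / |R_J|` over the `J` with `h ∈ R_J` does not depend on the relay `h` and equals its
average (`share_eq_of_symm`): `|Z_{g+1}| / H` on a server link and `(S₁ - S₂) / r` on a user link,
with `K (S₁ - S₂) = g |Z_{g+1}|`. The cross messages are counted by another inclusion-exclusion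
(`card_crossPairs`). The bound `|R_W| ≤ y*` (`card_commonRelays_le_yStar`) makes `c = L / y*` fit
into a symbol and makes the maximum with `0` harmless.

Existence. Reed-Solomon codes exist once `2 ^ L ≥ |Z_g|`, and `H! ∣ L` makes all divisions into
equal parts exact.

Memory sharing. The points attained with zero error for every file length, up to a bounded overhead
on the links and none in the caches, form a convex set (`convex_boundedOverhead`) that contains the
corner points. The overhead vanishes relative to `B`. -/

namespace CombNet

/-! ## Counting lemmas -/

/-- Inclusion-exclusion for a family whose intersections have cardinalities depending only on the
number of the sets that are intersected. -/
theorem card_filter_exists {α ι : Type*} [DecidableEq α] (X : Finset α) (s : Finset ι)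
    (P : ι → α → Prop) [∀ i, DecidablePred (P i)] [DecidablePred fun x => ∃ i ∈ s, P i x]
    (f : ℕ → ℤ)
    (hf : ∀ t ⊆ s, t.Nonempty → ((X.filter fun x => ∀ i ∈ t, P i x).card : ℤ) = f t.card) :
    ((X.filter fun x => ∃ i ∈ s, P i x).card : ℤ) =
      ∑ a ∈ Finset.Icc 1 s.card, (s.card.choose a : ℤ) * f a * (-1) ^ (a - 1) := by
  classical
  have h1 : (X.filter fun x => ∃ i ∈ s, P i x) = s.biUnion fun i => X.filter (P i) := by
    ext x
    simp only [Finset.mem_filter, Finset.mem_biUnion]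
    constructor
    · rintro ⟨hx, i, hi, h⟩
      exact ⟨i, hi, hx, h⟩
    · rintro ⟨i, hi, hx, h⟩
      exact ⟨hx, i, hi, h⟩
  rw [h1, Finset.inclusion_exclusion_card_biUnion]
  have h2 : ∀ t ⊆ s, ∀ ht : t.Nonempty,
      ((t.inf' ht fun i => X.filter (P i)).card : ℤ) = f t.card := by
    intro t hts ht
    rw [← hf t hts ht]
    refine congrArg (fun s : Finset α => (s.card : ℤ)) (Finset.ext fun x => ?_)
    rw [Finset.mem_inf']
    simp only [Finset.mem_filter]
    constructor
    · intro h
      obtain ⟨i, hi⟩ := ht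
      exact ⟨(h i hi).1, fun j hj => (h j hj).2⟩
    · exact fun h i hi => ⟨h.1, h.2 i hi⟩
  rw [Finset.sum_congr rfl fun t _ => by
      rw [h2 t.1 (Finset.mem_powerset.1 (Finset.mem_filter.1 t.2).1)],
    Finset.sum_coe_sort (s.powerset.filter (·.Nonempty))
      (fun t => (-1) ^ (t.card + 1) * f t.card), Finset.sum_filter]
  -- The value `f 0` is unconstrained, so the empty intersection is given weight `0` before subsets
  -- are grouped by size.
  have h3 := Finset.sum_powerset_apply_card
    (fun n => if n = 0 then 0 else (-1) ^ (n + 1) * f n) (x := s)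
  rw [show (∑ t ∈ s.powerset, if t.Nonempty then (-1 : ℤ) ^ (t.card + 1) * f t.card else 0) =
    ∑ t ∈ s.powerset, if t.card = 0 then 0 else (-1) ^ (t.card + 1) * f t.card from
      Finset.sum_congr rfl fun t _ => by
        by_cases ht : t = ∅
        · simp [ht]
        · rw [if_pos (Finset.nonempty_iff_ne_empty.2 ht), if_neg (by simpa using ht)],
    h3, Finset.sum_range_succ', if_pos rfl, smul_zero, add_zero]
  refine Finset.sum_bij' (fun a _ => a + 1) (fun a _ => a - 1) ?_ ?_ ?_ ?_ ?_
  · intro a ha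
    rw [Finset.mem_range] at ha
    rw [Finset.mem_Icc]
    omega
  · intro a ha
    rw [Finset.mem_Icc] at ha
    rw [Finset.mem_range]
    omega
  · simp
  · intro a ha
    rw [Finset.mem_Icc] at ha
    omega
  · intro a _
    rw [if_neg (Nat.succ_ne_zero a), nsmul_eq_mul, Nat.add_sub_cancel]
    ring

variable {H r : ℕ}

/-! ### Users, and sets of users, connected to given relays -/

/-- The users connected to all relays in `A`. -/
def usersOf (H r : ℕ) (A : Finset (Fin H)) : Finset (User H r) :=
  Finset.univ.filter fun k => A ⊆ k.1

@[simp] theorem mem_usersOf {A : Finset (Fin H)} {k : User H r} :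
    k ∈ usersOf H r A ↔ A ⊆ k.1 := by simp [usersOf]

@[simp] theorem mem_commonRelays {W : Finset (User H r)} {h : Fin H} :
    h ∈ commonRelays W ↔ ∀ k ∈ W, h ∈ k.1 := by simp [commonRelays]

theorem subset_commonRelays_iff {W : Finset (User H r)} {A : Finset (Fin H)} :
    A ⊆ commonRelays W ↔ W ⊆ usersOf H r A := by
  constructor
  · intro h k hk
    rw [mem_usersOf]
    exact fun a ha => mem_commonRelays.1 (h ha) k hk
  · intro h a ha
    rw [mem_commonRelays]
    exact fun k hk => mem_usersOf.1 (h hk) ha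

theorem mem_commonRelays_iff_subset {W : Finset (User H r)} {h : Fin H} :
    h ∈ commonRelays W ↔ W ⊆ usersOf H r {h} := by
  rw [← subset_commonRelays_iff, Finset.singleton_subset_iff]

theorem binom_natCast (x y : ℕ) : binom x y = x.choose y := by simp [binom]

theorem card_usersOf {A : Finset (Fin H)} (hA : A.card ≤ r) :
    ((usersOf H r A).card : ℤ) = numUsers H r A.card := by
  have hAH : A.card ≤ H := by simpa using A.card_le_univ
  rw [numUsers, ← Nat.cast_sub hA, ← Nat.cast_sub hAH, binom_natCast, Nat.cast_inj]
  have : H - A.card = Aᶜ.card := by rw [Finset.card_compl, Fintype.card_fin]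
  rw [this, ← Finset.card_powersetCard]
  refine Finset.card_bij' (fun k _ => k.1 \ A)
    (fun s hs => ⟨s ∪ A, by
      rw [Finset.mem_powersetCard] at hs
      rw [Finset.card_union_of_disjoint, hs.2]
      · omega
      · exact Finset.disjoint_left.2 fun x hx hxA => (Finset.mem_compl.1 (hs.1 hx)) hxA⟩) ?_ ?_ ?_ ?_
  · intro k hk
    rw [mem_usersOf] at hk
    rw [Finset.mem_powersetCard, Finset.card_sdiff_of_subset hk, k.2]
    exact ⟨fun x hx => Finset.mem_compl.2 (Finset.mem_sdiff.1 hx).2, rfl⟩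
  · intro s hs
    simp
  · intro k hk
    rw [mem_usersOf] at hk
    exact Subtype.ext (Finset.sdiff_union_of_subset hk)
  · intro s hs
    rw [Finset.mem_powersetCard] at hs
    rw [Finset.union_sdiff_right, Finset.sdiff_eq_self_iff_disjoint]
    exact Finset.disjoint_left.2 fun x hx hxA => (Finset.mem_compl.1 (hs.1 hx)) hxA

theorem numUsers_nonneg (H r a : ℕ) : 0 ≤ numUsers H r a := by
  unfold numUsers binom
  split_ifs <;> simp

theorem numUsers_pos {a : ℕ} (ha : a ≤ r) (hr : r ≤ H) : 0 < numUsers H r a := by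
  rw [numUsers, ← Nat.cast_sub ha, ← Nat.cast_sub (ha.trans hr), binom_natCast, Nat.cast_pos]
  exact Nat.choose_pos (by omega)

/-- The sets of `n` users that are all connected to all relays in `A`. -/
theorem card_filter_subset_commonRelays (n : ℕ) {A : Finset (Fin H)} (hA : A.card ≤ r) :
    ((Finset.univ.filter fun W : Finset (User H r) =>
      W.card = n ∧ A ⊆ commonRelays W).card : ℤ) = binom (numUsers H r A.card) n := by
  rw [← card_usersOf hA, binom_natCast, ← Finset.card_powersetCard]
  congr 2
  ext W
  simp [subset_commonRelays_iff, and_comm]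

theorem card_filter_subset_commonRelays_mem (n : ℕ) {A : Finset (Fin H)} (k : User H r)
    (hk : A ⊆ k.1) :
    ((Finset.univ.filter fun W : Finset (User H r) =>
      (W.card = n ∧ A ⊆ commonRelays W) ∧ k ∈ W).card : ℤ) =
      binom (numUsers H r A.card - 1) ((n : ℤ) - 1) := by
  have hA : A.card ≤ r := (Finset.card_le_card hk).trans_eq k.2
  have hkA : k ∈ usersOf H r A := mem_usersOf.2 hk
  have hpos : 1 ≤ (usersOf H r A).card := Finset.card_pos.2 ⟨k, hkA⟩
  -- For `n = 0` the right side is `0` only by the convention on negative lower arguments; `S₂`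
  -- relies on this at `g = 1`.
  rcases Nat.eq_zero_or_pos n with rfl | hn
  · have : (Finset.univ.filter fun W : Finset (User H r) =>
        (W.card = 0 ∧ A ⊆ commonRelays W) ∧ k ∈ W) = ∅ := by
      ext W
      simp only [Finset.card_eq_zero, Finset.mem_filter, Finset.mem_univ, true_and,
        Finset.notMem_empty, iff_false]
      rintro ⟨⟨rfl, -⟩, h⟩
      simp at h
    rw [this]
    simp [binom]
  · rw [← card_usersOf hA, ← Nat.cast_pred hpos, ← Nat.cast_pred hn, binom_natCast, Nat.cast_inj,
      ← Finset.card_erase_of_mem hkA, ← Finset.card_powersetCard]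
    refine Finset.card_bij' (fun W _ => W.erase k) (fun W _ => insert k W) ?_ ?_ ?_ ?_
    · intro W hW
      simp only [Finset.mem_filter, Finset.mem_univ, true_and, subset_commonRelays_iff] at hW
      rw [Finset.mem_powersetCard, Finset.card_erase_of_mem hW.2, hW.1.1]
      exact ⟨Finset.erase_subset_erase _ hW.1.2, rfl⟩
    · intro W hW
      rw [Finset.mem_powersetCard] at hW
      simp only [Finset.mem_filter, Finset.mem_univ, true_and, subset_commonRelays_iff]
      have hkW : k ∉ W := fun h => by simpa using hW.1 h
      refine ⟨⟨?_, ?_⟩, Finset.mem_insert_self _ _⟩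
      · rw [Finset.card_insert_of_notMem hkW, hW.2]
        omega
      · exact Finset.insert_subset hkA (hW.1.trans (Finset.erase_subset _ _))
    · intro W hW
      simp only [Finset.mem_filter] at hW
      exact Finset.insert_erase hW.2.2
    · intro W hW
      rw [Finset.mem_powersetCard] at hW
      exact Finset.erase_insert fun h => by simpa using hW.1 h

theorem commonRelays_subset {W : Finset (User H r)} {k : User H r} (hk : k ∈ W) :
    commonRelays W ⊆ k.1 := fun _ h => mem_commonRelays.1 h k hk

theorem commonRelays_anti {W W' : Finset (User H r)} (h : W ⊆ W') :
    commonRelays W' ⊆ commonRelays W :=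
  fun _ ha => mem_commonRelays.2 fun k hk => mem_commonRelays.1 ha k (h hk)

theorem mem_commonRelays_insert {W : Finset (User H r)} {k : User H r} {h : Fin H} :
    h ∈ commonRelays (insert k W) ↔ h ∈ k.1 ∧ h ∈ commonRelays W := by
  simp

/-- The symbols that user `k` has or recovers. -/
def neededSets (g : ℕ) (k : User H r) : Finset (Finset (User H r)) :=
  Finset.univ.filter fun W => W.card + 1 = g ∧ (commonRelays (insert k W)).Nonempty

/-- The sets of `g` users that have a common relay and contain `k`. -/
def multicastSets (g : ℕ) (k : User H r) : Finset (Finset (User H r)) :=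
  Finset.univ.filter fun J => (J.card = g ∧ (commonRelays J).Nonempty) ∧ k ∈ J

theorem neededSets_subset (g : ℕ) (k : User H r) : neededSets g k ⊆ subfileSets H r g := by
  intro W hW
  simp only [neededSets, subfileSets, Finset.mem_filter, Finset.mem_univ, true_and] at hW ⊢
  exact ⟨hW.1, hW.2.mono (commonRelays_anti (Finset.subset_insert _ _))⟩

/-- The needed sets are the union, over the `r` relays of `k`, of the sets of `g - 1` users of that
relay. An intersection over `a` relays has `binom K_a (g - 1)` elements. -/
theorem card_neededSets {g : ℕ} (hg : 1 ≤ g) (k : User H r) :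
    ((neededSets g k).card : ℤ) = S₁ H r g := by
  have key := card_filter_exists
    (Finset.univ.filter fun W : Finset (User H r) => W.card = g - 1) k.1
    (fun h W => h ∈ commonRelays W) (fun a => binom (numUsers H r a) ((g : ℤ) - 1)) (by
      intro t ht _
      have := card_filter_subset_commonRelays (g - 1) ((Finset.card_le_card ht).trans_eq k.2)
      rw [Nat.cast_pred hg] at this
      rw [← this, Finset.filter_filter]
      rfl)
  rw [k.2, Finset.filter_filter] at key
  rw [S₁]
  simp only [binom_natCast]
  rw [← key, neededSets, Nat.cast_inj]
  congr 1
  ext W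
  simp only [Finset.mem_filter, Finset.mem_univ, true_and]
  refine and_congr (by omega) (exists_congr fun h => mem_commonRelays_insert)

theorem card_filter_mem_subfileSets {g : ℕ} (hg : 1 ≤ g) (k : User H r) :
    (((subfileSets H r g).filter fun W => k ∈ W).card : ℤ) = S₂ H r g := by
  have key := card_filter_exists
    (Finset.univ.filter fun W : Finset (User H r) => W.card = g - 1 ∧ k ∈ W) k.1
    (fun h W => h ∈ commonRelays W) (fun a => binom (numUsers H r a - 1) ((g : ℤ) - 2)) (by
      intro t ht _
      have := card_filter_subset_commonRelays_mem (g - 1) k ht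
      rw [Nat.cast_pred hg, sub_sub] at this
      rw [show (g : ℤ) - 2 = g - (1 + 1) by ring, ← this, Finset.filter_filter]
      refine congrArg (fun s : Finset _ => (s.card : ℤ)) (Finset.ext fun W => ?_)
      simp only [Finset.mem_filter, Finset.mem_univ, true_and]
      rw [and_right_comm]
      rfl)
  rw [k.2, Finset.filter_filter] at key
  rw [S₂]
  simp only [binom_natCast]
  rw [← key, subfileSets, Finset.filter_filter, Nat.cast_inj]
  congr 1
  ext W
  simp only [Finset.mem_filter, Finset.mem_univ, true_and]
  constructor
  · rintro ⟨⟨h1, h, hh⟩, h2⟩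
    exact ⟨⟨by omega, h2⟩, h, commonRelays_subset h2 hh, hh⟩
  · rintro ⟨⟨h1, h2⟩, h, -, hh⟩
    exact ⟨⟨by omega, h, hh⟩, h2⟩

/-- `J ↦ J \ {k}` is a bijection onto the needed sets that avoid `k`. The needed sets that contain
`k` are the `S₂` members of `Z_g` containing `k`. -/
theorem card_multicastSets {g : ℕ} (hg : 1 ≤ g) (k : User H r) :
    ((multicastSets g k).card : ℤ) = S₁ H r g - S₂ H r g := by
  rw [eq_sub_iff_add_eq, ← card_neededSets hg k, ← card_filter_mem_subfileSets hg k,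
    ← Nat.cast_add, Nat.cast_inj, ← Finset.card_filter_add_card_filter_not (s := neededSets g k)
      (fun W => k ∈ W), add_comm]
  refine congrArg₂ (· + ·) (congrArg Finset.card ?_) ?_
  · ext W
    simp only [neededSets, subfileSets, Finset.mem_filter, Finset.mem_univ, true_and]
    refine and_congr_left fun hk => ?_
    rw [Finset.insert_eq_of_mem hk]
  · refine Finset.card_bij' (fun W _ => W.erase k) (fun W _ => insert k W) ?_ ?_ ?_ ?_
    · intro J hJ
      simp only [multicastSets, neededSets, Finset.mem_filter, Finset.mem_univ, true_and] at hJ ⊢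
      rw [Finset.insert_erase hJ.2, Finset.card_erase_of_mem hJ.2]
      exact ⟨⟨by omega, hJ.1.2⟩, by simp⟩
    · intro W hW
      simp only [multicastSets, neededSets, Finset.mem_filter, Finset.mem_univ, true_and] at hW ⊢
      rw [Finset.card_insert_of_notMem hW.2]
      exact ⟨hW.1, Finset.mem_insert_self _ _⟩
    · intro J hJ
      simp only [multicastSets, Finset.mem_filter] at hJ
      exact Finset.insert_erase hJ.2.2
    · intro W hW
      simp only [Finset.mem_filter] at hW
      exact Finset.erase_insert hW.2

/-! ### Symmetry -/

/-- The action of a permutation of the relays on the users. -/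
def userPerm (r : ℕ) (σ : Equiv.Perm (Fin H)) : Equiv.Perm (User H r) where
  toFun k := ⟨k.1.map σ.toEmbedding, by rw [Finset.card_map, k.2]⟩
  invFun k := ⟨k.1.map σ.symm.toEmbedding, by rw [Finset.card_map, k.2]⟩
  left_inv k := Subtype.ext (by ext; simp)
  right_inv k := Subtype.ext (by ext; simp)

theorem mem_userPerm {σ : Equiv.Perm (Fin H)} {k : User H r} {h : Fin H} :
    h ∈ (userPerm r σ k).1 ↔ σ.symm h ∈ k.1 := by
  simp [userPerm]

theorem commonRelays_map (σ : Equiv.Perm (Fin H)) (W : Finset (User H r)) :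
    commonRelays (W.map (userPerm r σ).toEmbedding) =
      (commonRelays W).map σ.toEmbedding := by
  ext h
  rw [Finset.mem_map_equiv, mem_commonRelays, mem_commonRelays]
  constructor
  · intro hh k hk
    have := hh (userPerm r σ k) (Finset.mem_map_of_mem _ hk)
    rwa [mem_userPerm] at this
  · intro hh k hk
    obtain ⟨k, hkW, rfl⟩ := Finset.mem_map.1 hk
    rw [Equiv.coe_toEmbedding]
    exact mem_userPerm.2 (hh _ hkW)

/-- The share of relay `h` in a quantity that is divided equally among the common relays. -/
noncomputable def share (X : Finset (Finset (User H r))) (h : Fin H) : ℝ :=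
  ∑ J ∈ X.filter fun J => h ∈ commonRelays J, 1 / ((commonRelays J).card : ℝ)

theorem share_perm (X : Finset (Finset (User H r))) (σ : Equiv.Perm (Fin H))
    (hX : ∀ J, J.map (userPerm r σ).toEmbedding ∈ X ↔ J ∈ X) (h : Fin H) :
    share X (σ h) = share X h := by
  unfold share
  symm
  refine Finset.sum_equiv (Equiv.finsetCongr (userPerm r σ)) ?_ ?_
  · intro J
    rw [Finset.mem_filter, Finset.mem_filter, Equiv.finsetCongr_apply, hX, commonRelays_map,
      Finset.mem_map_equiv, Equiv.symm_apply_apply]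
  · intro J _
    rw [Equiv.finsetCongr_apply, commonRelays_map, Finset.card_map]

theorem sum_share (X : Finset (Finset (User H r))) (T : Finset (Fin H))
    (hX : ∀ J ∈ X, (commonRelays J).Nonempty ∧ commonRelays J ⊆ T) :
    ∑ h ∈ T, share X h = X.card := by
  unfold share
  simp only [Finset.sum_filter]
  rw [Finset.sum_comm]
  have : ∀ J ∈ X, (∑ h ∈ T, if h ∈ commonRelays J then 1 / ((commonRelays J).card : ℝ) else 0) =
      1 := by
    intro J hJ
    rw [← Finset.sum_filter, Finset.filter_mem_eq_inter,
      Finset.inter_eq_right.2 (hX J hJ).2, Finset.sum_const, nsmul_eq_mul, mul_one_div,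
      div_self (Nat.cast_ne_zero.2 (Finset.card_pos.2 (hX J hJ).1).ne')]
  rw [Finset.sum_congr rfl this]
  simp

/-- Transpositions of relays in `T` preserve `X`, so all relays in `T` have the same share. Each `J`
distributes a total of `1`, so the shares add up to `|X|`. -/
theorem share_eq_of_symm (X : Finset (Finset (User H r))) (T : Finset (Fin H))
    (hX : ∀ J ∈ X, (commonRelays J).Nonempty ∧ commonRelays J ⊆ T)
    (hs : ∀ h ∈ T, ∀ h' ∈ T, ∀ J, J.map (userPerm r (Equiv.swap h h')).toEmbedding ∈ X ↔ J ∈ X)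
    {h : Fin H} (hh : h ∈ T) : share X h = X.card / T.card := by
  have h1 : ∀ h' ∈ T, share X h' = share X h := by
    intro h' hh'
    have := share_perm X (Equiv.swap h h') (hs h hh h' hh') h
    rwa [Equiv.swap_apply_left] at this
  rw [← sum_share X T hX, Finset.sum_congr rfl h1, Finset.sum_const, nsmul_eq_mul,
    mul_div_cancel_left₀ _ (Nat.cast_ne_zero.2 (Finset.card_pos.2 ⟨h, hh⟩).ne')]

theorem share_multicastSets (g : ℕ) (k : User H r) {h : Fin H} (hh : h ∈ k.1) :
    share (multicastSets g k) h = (multicastSets g k).card / r := by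
  rw [share_eq_of_symm _ k.1 _ _ hh, k.2]
  · intro J hJ
    simp only [multicastSets, Finset.mem_filter, Finset.mem_univ, true_and] at hJ
    exact ⟨hJ.1.2, commonRelays_subset hJ.2⟩
  · intro h1 hh1 h2 hh2 J
    -- Both swapped relays belong to `k`, so the condition `k ∈ J` is preserved.
    have hk : userPerm r (Equiv.swap h1 h2) k = k := by
      refine Subtype.ext (Finset.ext fun x => ?_)
      rw [mem_userPerm, Equiv.symm_swap, Equiv.swap_apply_def]
      split_ifs with ha hb
      · simp [ha, hh1, hh2]
      · simp [hb, hh1, hh2]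
      · rfl
    have hk' : (userPerm r (Equiv.swap h1 h2)).symm k = k := by
      rw [Equiv.symm_apply_eq, hk]
    simp only [multicastSets, Finset.mem_filter, Finset.mem_univ, true_and, Finset.card_map,
      commonRelays_map, Finset.map_nonempty, Finset.mem_map_equiv, hk']

theorem share_subfileSets (g : ℕ) (h : Fin H) :
    share (subfileSets H r (g + 1)) h = (subfileSets H r (g + 1)).card / H := by
  rw [share_eq_of_symm _ Finset.univ _ _ (Finset.mem_univ h), Finset.card_univ, Fintype.card_fin]
  · intro J hJ
    simp only [subfileSets, Finset.mem_filter, Finset.mem_univ, true_and] at hJ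
    exact ⟨hJ.2, Finset.subset_univ _⟩
  · intro h1 _ h2 _ J
    simp only [subfileSets, Finset.mem_filter, Finset.mem_univ, true_and, Finset.card_map,
      commonRelays_map, Finset.map_nonempty]

/-! ### Double counting -/

theorem card_user (H r : ℕ) : (Fintype.card (User H r) : ℤ) = numUsers H r 0 := by
  have := card_usersOf (H := H) (r := r) (A := ∅) (by simp)
  rw [Finset.card_empty] at this
  rw [← this, Nat.cast_inj, ← Finset.card_univ]
  congr 1
  ext k
  simp

/-- Both sides count the pairs `k ∈ J`, where `J` is a set of `g` users with a common relay. -/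
theorem numUsers_zero_mul {g : ℕ} (hg : 1 ≤ g) :
    numUsers H r 0 * (S₁ H r g - S₂ H r g) = g * (subfileSets H r (g + 1)).card := by
  have h1 : ∑ k : User H r, ((multicastSets g k).card : ℤ) =
      numUsers H r 0 * (S₁ H r g - S₂ H r g) := by
    rw [Finset.sum_congr rfl fun k _ => card_multicastSets hg k, Finset.sum_const,
      Finset.card_univ, nsmul_eq_mul, card_user]
  rw [← h1]
  simp only [multicastSets]
  have h2 : ∀ k : User H r, (Finset.univ.filter fun J : Finset (User H r) =>
      (J.card = g ∧ (commonRelays J).Nonempty) ∧ k ∈ J) =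
      (subfileSets H r (g + 1)).filter fun J => k ∈ J := by
    intro k
    ext J
    simp [subfileSets]
  simp only [h2, Finset.card_filter, Nat.cast_sum]
  rw [Finset.sum_comm]
  have h3 : ∀ J ∈ subfileSets H r (g + 1),
      (∑ k : User H r, ((if k ∈ J then 1 else 0 : ℕ) : ℤ)) = g := by
    intro J hJ
    simp only [subfileSets, Finset.mem_filter, Finset.mem_univ, true_and] at hJ
    rw [← Nat.cast_sum, ← Finset.card_filter, Finset.filter_mem_eq_inter, Finset.univ_inter]
    have := hJ.1
    simpa using this
  rw [Finset.sum_congr rfl h3]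
  simp [mul_comm]

/-- Counts pairs `(W, h)` with `h ∈ R_W`. As `k ∈ W`, only the `r` relays of `k` occur, and each
contributes the sets of its users that contain `k`. -/
theorem sum_card_commonRelays {g : ℕ} (hg : 1 ≤ g) (k : User H r) :
    ((∑ W ∈ (subfileSets H r g).filter (fun W => k ∈ W), (commonRelays W).card : ℕ) : ℤ) =
      r * binom (numUsers H r 1 - 1) ((g : ℤ) - 2) := by
  have h1 : ∀ W ∈ (subfileSets H r g).filter (fun W => k ∈ W), (commonRelays W).card =
      ∑ h ∈ k.1, if h ∈ commonRelays W then 1 else 0 := by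
    intro W hW
    rw [← Finset.card_filter, Finset.filter_mem_eq_inter,
      Finset.inter_eq_right.2 (commonRelays_subset (Finset.mem_filter.1 hW).2)]
  rw [Finset.sum_congr rfl h1, Finset.sum_comm, Nat.cast_sum]
  have h2 : ∀ h ∈ k.1, ((∑ W ∈ (subfileSets H r g).filter (fun W => k ∈ W),
      (if h ∈ commonRelays W then 1 else 0) : ℕ) : ℤ) =
      binom (numUsers H r 1 - 1) ((g : ℤ) - 2) := by
    intro h hh
    have := card_filter_subset_commonRelays_mem (g - 1) k (Finset.singleton_subset_iff.2 hh)
    rw [Nat.cast_pred hg, sub_sub, Finset.card_singleton] at this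
    rw [show (g : ℤ) - 2 = g - (1 + 1) by ring, ← this, ← Finset.card_filter, Nat.cast_inj,
      subfileSets, Finset.filter_filter, Finset.filter_filter]
    congr 1
    ext W
    simp only [Finset.mem_filter, Finset.mem_univ, true_and, Finset.singleton_subset_iff]
    constructor
    · rintro ⟨⟨h1, h2⟩, h3, h4⟩
      exact ⟨⟨by omega, h4⟩, h3⟩
    · rintro ⟨⟨h1, h4⟩, h3⟩
      exact ⟨⟨by omega, h, h4⟩, h3, h4⟩
  rw [Finset.sum_congr rfl h2, Finset.sum_const, k.2, nsmul_eq_mul]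

theorem card_usersOf_not_mem {A : Finset (Fin H)} {h : Fin H} (hA : h ∉ A) (hr : A.card < r) :
    (((usersOf H r A).filter fun k => h ∉ k.1).card : ℤ) =
      numUsers H r A.card - numUsers H r (A.card + 1) := by
  rw [← Finset.card_insert_of_notMem hA, ← card_usersOf hr.le,
    ← card_usersOf (by rw [Finset.card_insert_of_notMem hA]; omega), eq_sub_iff_add_eq,
    ← Nat.cast_add, Nat.cast_inj, ← Finset.card_filter_add_card_filter_not
      (s := usersOf H r A) (fun k => h ∈ k.1), add_comm]
  congr 2
  ext k
  simp [Finset.insert_subset_iff, and_comm]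

/-- The pairs of a set `W` containing `k` and a user `k'` for which relay `h` sends to user `k` what
it caches of the symbol requested by `k'`. -/
def crossPairs (g : ℕ) (k : User H r) (h : Fin H) : Finset (User H r × Finset (User H r)) :=
  Finset.univ.filter fun x => (x.2 ∈ subfileSets H r g ∧ h ∈ commonRelays x.2) ∧ k ∈ x.2 ∧
    1 < (commonRelays x.2).card ∧ h ∉ x.1.1 ∧ (commonRelays (insert x.1 x.2)).Nonempty

/-- A common relay `h'` of `W ∪ {k'}` belongs to `k` and differs from `h`, since `h` is not
connected to `k'`; thus `|R_W| > 1` is automatic. Inclusion-exclusion runs over the `r - 1` other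
relays of `k`. Once `a` of them are prescribed, `W` and `k'` are chosen independently, with `binom
(K_{a+1} - 1) (g - 2)` and `K_a - K_{a+1}` choices. -/
theorem card_crossPairs {g : ℕ} (hg : 2 ≤ g) (k : User H r) {h : Fin H} (hh : h ∈ k.1) :
    ((crossPairs g k h).card : ℤ) = ∑ b ∈ Finset.Icc 2 r, binom ((r : ℤ) - 1) ((b : ℤ) - 1) *
          binom (numUsers H r b - 1) ((g : ℤ) - 2) *
          (numUsers H r (b - 1) - numUsers H r b) * (-1) ^ b := by
  have hr : 1 ≤ r := by rw [← k.2]; exact Finset.card_pos.2 ⟨h, hh⟩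
  have hcard : (k.1.erase h).card = r - 1 := by rw [Finset.card_erase_of_mem hh, k.2]
  have key := card_filter_exists
    (Finset.univ.filter fun x : User H r × Finset (User H r) =>
      (x.2.card = g - 1 ∧ h ∈ commonRelays x.2) ∧ k ∈ x.2 ∧ h ∉ x.1.1) (k.1.erase h)
    (fun h' x => h' ∈ x.1.1 ∧ h' ∈ commonRelays x.2)
    (fun a => binom (numUsers H r (a + 1) - 1) ((g : ℤ) - 2) *
      (numUsers H r a - numUsers H r (a + 1))) (by
      intro t ht _
      have hht : h ∉ t := fun hc => by simpa using ht hc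
      have htr : t.card < r := by
        have := Finset.card_le_card ht
        omega
      have hsub : insert h t ⊆ k.1 :=
        Finset.insert_subset hh (ht.trans (Finset.erase_subset _ _))
      have h1 := card_filter_subset_commonRelays_mem (g - 1) k hsub
      rw [Nat.cast_pred (by omega), sub_sub, Finset.card_insert_of_notMem hht] at h1
      rw [show (g : ℤ) - 2 = g - (1 + 1) by ring, ← h1, ← card_usersOf_not_mem hht htr,
        mul_comm, ← Nat.cast_mul, ← Finset.card_product, Nat.cast_inj, Finset.filter_filter]
      congr 1
      ext x
      simp only [Finset.mem_filter, Finset.mem_univ, true_and, Finset.mem_product,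
        mem_usersOf, Finset.insert_subset_iff]
      constructor
      · rintro ⟨⟨⟨h1, h2⟩, h3, h4⟩, h5⟩
        exact ⟨⟨fun i hi => (h5 i hi).1, h4⟩, ⟨h1, h2, fun i hi => (h5 i hi).2⟩, h3⟩
      · rintro ⟨⟨h5, h4⟩, ⟨h1, h2, h6⟩, h3⟩
        exact ⟨⟨⟨h1, h2⟩, h3, h4⟩, fun i hi => ⟨h5 hi, h6 hi⟩⟩)
  have h2 : crossPairs g k h = Finset.filter (fun x : User H r × Finset (User H r) =>
      ∃ i ∈ k.1.erase h, i ∈ x.1.1 ∧ i ∈ commonRelays x.2)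
      (Finset.univ.filter fun x : User H r × Finset (User H r) =>
      (x.2.card = g - 1 ∧ h ∈ commonRelays x.2) ∧ k ∈ x.2 ∧ h ∉ x.1.1) := by
    ext ⟨k', W⟩
    simp only [crossPairs, subfileSets, Finset.mem_filter, Finset.mem_univ, true_and,
      Finset.mem_erase]
    constructor
    · rintro ⟨⟨⟨h1, h2⟩, h3⟩, h4, h5, h6, h', h7⟩
      rw [mem_commonRelays_insert] at h7
      refine ⟨⟨⟨by omega, h3⟩, h4, h6⟩, h', ⟨?_, commonRelays_subset h4 h7.2⟩, h7⟩
      rintro rfl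
      exact h6 h7.1
    · rintro ⟨⟨⟨h1, h3⟩, h4, h6⟩, h', ⟨hne, h8⟩, h7⟩
      refine ⟨⟨⟨by omega, h, h3⟩, h3⟩, h4, ?_, h6, h', mem_commonRelays_insert.2 h7⟩
      exact Finset.one_lt_card.2 ⟨h', h7.2, h, h3, hne⟩
  rw [h2, key, hcard]
  -- With `b = a + 1`, counting `h` among the prescribed relays, the sign `(-1) ^ (a - 1)` equals
  -- `(-1) ^ b`.
  refine Finset.sum_bij' (fun a _ => a + 1) (fun b _ => b - 1) ?_ ?_ ?_ ?_ ?_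
  · intro a ha
    rw [Finset.mem_Icc] at ha ⊢
    omega
  · intro b hb
    rw [Finset.mem_Icc] at hb ⊢
    omega
  · simp
  · intro b hb
    rw [Finset.mem_Icc] at hb
    omega
  · intro a ha
    rw [Finset.mem_Icc] at ha
    obtain ⟨a, rfl⟩ : ∃ b, a = b + 1 := ⟨a - 1, by omega⟩
    rw [← Nat.cast_pred hr, ← Nat.cast_pred (Nat.succ_pos _), binom_natCast]
    simp only [Nat.add_sub_cancel]
    push_cast
    ring

/-! ## The scheme with gain `g` -/

/-- The decoder picks any library consistent with the view; all consistent libraries agree on the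
requested file. -/
theorem Code.recovers_zero {H r N B : ℕ} (C : Code H r N B) (d : Demand H r N)
    (h : ∀ k F F', C.view d F k = C.view d F' k → F (d k) = F' (d k)) : C.Recovers d 0 := by
  classical
  refine ⟨fun k v => if hv : ∃ F, C.view d F k = v then hv.choose (d k) else 0, ?_⟩
  have : {F : Files N B | ∃ k, (if hv : ∃ F', C.view d F' k = C.view d F k then hv.choose (d k)
      else 0) ≠ F (d k)} = ∅ := by
    rw [Set.eq_empty_iff_forall_notMem]
    rintro F ⟨k, hk⟩
    have hv : ∃ F', C.view d F' k = C.view d F k := ⟨F, rfl⟩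
    rw [dif_pos hv] at hk
    exact hk (h k _ _ hv.choose_spec)
  rw [this]
  simp

theorem Code.Recovers.determined {H r N B : ℕ} {C : Code H r N B} {d : Demand H r N}
    (hC : C.Recovers d 0) {k : User H r} {F F' : Files N B}
    (h : C.view d F k = C.view d F' k) : F (d k) = F' (d k) := by
  obtain ⟨dec, hdec⟩ := hC
  rw [zero_mul] at hdec
  have h0 : {F : Files N B | ∃ k, dec k (C.view d F k) ≠ F (d k)} = ∅ := by
    rw [← Set.ncard_eq_zero]
    exact_mod_cast le_antisymm hdec (Nat.cast_nonneg _)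
  have h1 : ∀ F, dec k (C.view d F k) = F (d k) := by
    intro F
    by_contra hne
    exact Set.eq_empty_iff_forall_notMem.1 h0 F ⟨k, hne⟩
  rw [← h1 F, ← h1 F', h]

theorem pieces_injective {s L : ℕ} : Function.Injective (pieces (s := s) (L := L)) := by
  intro f f' h
  funext x
  have := congrFun (congrFun h (finProdFinEquiv.symm x).1) (finProdFinEquiv.symm x).2
  simpa only [pieces, Prod.mk.eta, Equiv.apply_symm_apply] using this

/-! ### Cardinalities of the index types -/

theorem natCard_subtype_prod {α β : Type*} [Fintype α] [Finite β] (P : α × β → Prop)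
    (s : Finset α) (Q : α → β → Prop) (h : ∀ a b, P (a, b) ↔ a ∈ s ∧ Q a b) :
    Nat.card {x // P x} = ∑ a ∈ s, Nat.card {b // Q a b} := by
  classical
  rw [Nat.card_congr ((Equiv.subtypeEquivRight (q := fun x : α × β => x.1 ∈ s ∧ Q x.1 x.2)
    fun x => h x.1 x.2).trans
    (Equiv.subtypeProdEquivSigmaSubtype fun a b => a ∈ s ∧ Q a b)), Nat.card_sigma]
  rw [← Finset.sum_subset (Finset.subset_univ s)]
  · refine Finset.sum_congr rfl fun a ha => Nat.card_congr (Equiv.subtypeEquivRight fun b => ?_)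
    simp [ha]
  · intro a _ ha
    simp [ha]

theorem natCard_subtype_prod_prod {α β γ : Type*} [Fintype α] [Fintype β] [Finite γ]
    (P : α × β × γ → Prop) (s : Finset (α × β)) (Q : α → β → γ → Prop)
    (h : ∀ a b c, P (a, b, c) ↔ (a, b) ∈ s ∧ Q a b c) :
    Nat.card {x // P x} = ∑ y ∈ s, Nat.card {c // Q y.1 y.2 c} := by
  rw [← natCard_subtype_prod (fun x : (α × β) × γ => P (x.1.1, x.1.2, x.2)) s
    (fun y c => Q y.1 y.2 c) fun a c => h a.1 a.2 c]
  exact Nat.card_congr ((Equiv.prodAssoc α β γ).symm.subtypeEquiv fun _ => Iff.rfl)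

theorem natCard_sigma_fin {α : Type*} [Fintype α] (P : α → Prop) [DecidablePred P] (f : α → ℕ) :
    Nat.card ((a : {a // P a}) × Fin (f a.1)) = ∑ a ∈ Finset.univ.filter P, f a := by
  rw [Nat.card_sigma]
  simp only [Nat.card_eq_fintype_card, Fintype.card_fin]
  exact (Finset.sum_subtype _ (by simp) f).symm

theorem card_filter_ne_some {H L c : ℕ} (o : Fin L → Option (Fin H)) (A : Finset (Fin H))
    (hA : ∀ h ∈ A, (Finset.univ.filter fun p => o p = some h).card = c) :
    (Finset.univ.filter fun p => ∀ h ∈ A, o p ≠ some h).card + A.card * c = L := by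
  have h1 : (Finset.univ.filter fun p => ¬ ∀ h ∈ A, o p ≠ some h) =
      A.biUnion fun h => Finset.univ.filter fun p => o p = some h := by
    ext p
    simp
  have h2 := Finset.card_filter_add_card_filter_not (s := (Finset.univ : Finset (Fin L)))
    (fun p => ∀ h ∈ A, o p ≠ some h)
  rw [h1, Finset.card_biUnion, Finset.sum_congr rfl hA,
    Finset.sum_const, smul_eq_mul, Finset.card_univ, Fintype.card_fin] at h2
  · exact h2
  · intro a _ b _ hab
    refine Finset.disjoint_left.2 fun p hp hp' => hab ?_
    rw [Finset.mem_filter] at hp hp'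
    exact Option.some.inj (hp.2.symm.trans hp'.2)

theorem card_filter_subfileSets {H r g : ℕ} (hg : 1 ≤ g) (hr : 1 ≤ r) (h : Fin H) :
    (((subfileSets H r g).filter fun W => h ∈ commonRelays W).card : ℝ) =
      binom (numUsers H r 1) ((g : ℤ) - 1) := by
  have h1 := card_filter_subset_commonRelays (r := r) (g - 1) (A := {h}) (by simpa using hr)
  rw [Nat.cast_pred hg, Finset.card_singleton] at h1
  rw [← h1, Int.cast_natCast, Nat.cast_inj, subfileSets, Finset.filter_filter]
  refine congrArg Finset.card (Finset.filter_congr fun W _ => ?_)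
  rw [Finset.singleton_subset_iff]
  exact ⟨fun hW => ⟨by omega, hW.2⟩, fun hW => ⟨⟨by omega, h, hW.2⟩, hW.2⟩⟩

namespace Design

variable {H r g L c : ℕ}

theorem natCard_owner_some (D : Design H r g L c) {W : Finset (User H r)}
    (hW : W ∈ subfileSets H r g) {h : Fin H} (hh : h ∈ commonRelays W) :
    Nat.card {p // D.owner W p = some h} = c := by
  rw [Nat.card_eq_fintype_card, Fintype.card_subtype, D.owner_card W hW h hh]

theorem card_filter_owner (D : Design H r g L c) {W : Finset (User H r)}
    (hW : W ∈ subfileSets H r g) {A : Finset (Fin H)} (hA : A ⊆ commonRelays W) :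
    (Finset.univ.filter fun p => ∀ h ∈ A, D.owner W p ≠ some h).card + A.card * c = L :=
  card_filter_ne_some _ A fun h hh => D.owner_card W hW h (hA hh)

theorem natCard_owner_none (D : Design H r g L c) {W : Finset (User H r)}
    (hW : W ∈ subfileSets H r g) :
    Nat.card {p // D.owner W p = none} + (commonRelays W).card * c = L := by
  refine Eq.trans ?_ (D.card_filter_owner hW subset_rfl)
  rw [Nat.card_eq_fintype_card, Fintype.card_subtype]
  congr 2
  refine Finset.filter_congr fun p _ => ?_
  constructor
  · intro h h' _
    rw [h]
    simp
  · intro h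
    rw [Option.eq_none_iff_forall_ne_some]
    exact fun h' hh' => h h' (D.owner_mem W hW p h' hh') hh'

theorem erase_mem_subfileSets {J : Finset (User H r)} (hJ : J.card = g)
    (hR : (commonRelays J).Nonempty) {k : User H r} (hk : k ∈ J) :
    J.erase k ∈ subfileSets H r g := by
  simp only [subfileSets, Finset.mem_filter, Finset.mem_univ, true_and]
  exact ⟨by rw [Finset.card_erase_add_one hk, hJ],
    hR.mono (commonRelays_anti (Finset.erase_subset _ _))⟩

/-- The definition of `partLen` truncates a difference and a quotient. The bijection `part_bijOn`
forces both to be exact, so no divisibility assumption is needed once a design is given. -/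
theorem partLen_eq (D : Design H r g L c) (hg : 1 ≤ g) {J : Finset (User H r)} (hJ : J.card = g)
    (hR : (commonRelays J).Nonempty) :
    (partLen L c J : ℝ) = L * (1 / ((commonRelays J).card : ℝ)) - c := by
  obtain ⟨k, hk⟩ : J.Nonempty := Finset.card_pos.1 (by omega)
  have h1 := D.card_filter_owner (erase_mem_subfileSets hJ hR hk)
    (commonRelays_anti (Finset.erase_subset k J))
  have h2 : (commonRelays J).card * partLen L c J =
      (Finset.univ.filter fun p => ∀ h ∈ commonRelays J, D.owner (J.erase k) p ≠ some h).card := by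
    have hb := D.part_bijOn J k hk hJ hR
    rw [← Set.ncard_coe_finset (Finset.univ.filter _), Finset.coe_filter]
    simp only [Finset.mem_univ, true_and]
    rw [← hb.image_eq, hb.injOn.ncard_image]
    have : {x : Fin H × Fin (partLen L c J) | x.1 ∈ commonRelays J} =
        ((commonRelays J ×ˢ Finset.univ : Finset (Fin H × Fin (partLen L c J))) : Set _) := by
      ext x
      simp
    rw [this, Set.ncard_coe_finset, Finset.card_product, Finset.card_univ, Fintype.card_fin]
  rw [← h2, ← mul_add] at h1
  have h3 : ((commonRelays J).card : ℝ) ≠ 0 := Nat.cast_ne_zero.2 (Finset.card_pos.2 hR).ne'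
  have h4 : ((commonRelays J).card : ℝ) * (partLen L c J + c) = L := by exact_mod_cast h1
  rw [mul_one_div, eq_sub_iff_add_eq, eq_div_iff h3, mul_comm, h4]

theorem sum_partLen (D : Design H r g L c) (hg : 1 ≤ g) (X : Finset (Finset (User H r)))
    (hX : ∀ J ∈ X, J.card = g) (h : Fin H) :
    ((∑ J ∈ X.filter fun J => h ∈ commonRelays J, partLen L c J : ℕ) : ℝ) =
      L * share X h - (X.filter fun J => h ∈ commonRelays J).card * c := by
  rw [share, Finset.mul_sum, Nat.cast_sum, ← nsmul_eq_mul, ← Finset.sum_const,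
    ← Finset.sum_sub_distrib]
  refine Finset.sum_congr rfl fun J hJ => ?_
  rw [Finset.mem_filter] at hJ
  exact D.partLen_eq hg (hX J hJ.1) ⟨h, hJ.2⟩

theorem recovers (D : Design H r g L c) (hg : 1 ≤ g) (N : ℕ) (d : Demand H r N) :
    (D.code N).Recovers d 0 := by
  refine Code.recovers_zero _ _ fun k F F' hv => ?_
  -- Equal views are split into the cache of `k` and the three kinds of messages (a), (b), (c).
  have hcache : ∀ i W, W ∈ subfileSets H r g → k ∈ W → ∀ p, D.owner W p = none →
      D.symbol F i W p = D.symbol F' i W p := by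
    intro i W hW hk p hp
    exact congrFun (congrArg Prod.fst hv) ⟨(i, W, p), hW, hk, hp⟩
  have hfwd := fun h : k.1 => congrFun (congrArg Prod.snd hv) h
  have hown : ∀ W ∈ subfileSets H r g, ∀ h ∈ k.1, ∀ p, D.owner W p = some h →
      D.symbol F (d k) W p = D.symbol F' (d k) W p := by
    intro W hW h hh p hp
    exact congrFun (hfwd ⟨h, hh⟩) (Sum.inl ⟨(W, p), hW, hp⟩)
  have hcross : ∀ W ∈ subfileSets H r g, ∀ h ∈ k.1, ∀ p, D.owner W p = some h → ∀ k', k ∈ W →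
      1 < (commonRelays W).card → h ∉ k'.1 → (commonRelays (insert k' W)).Nonempty →
      D.symbol F (d k') W p = D.symbol F' (d k') W p := by
    intro W hW h hh p hp k' h1 h2 h3 h4
    exact congrFun (hfwd ⟨h, hh⟩) (Sum.inr (Sum.inl ⟨(k', W, p), hW, hp, h1, h2, h3, h4⟩))
  have hmulti : ∀ J, J.card = g → k ∈ J → ∀ h ∈ commonRelays J, ∀ j : Fin (partLen L c J),
      ∑ k' ∈ J, D.symbol F (d k') (J.erase k') (D.part J k' h j) =
        ∑ k' ∈ J, D.symbol F' (d k') (J.erase k') (D.part J k' h j) := by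
    intro J hJ hk h hh j
    exact congrFun (hfwd ⟨h, commonRelays_subset hk hh⟩)
      (Sum.inr (Sum.inr ⟨⟨J, ⟨hJ, hh⟩, hk⟩, j⟩))
  have hneeded : ∀ W ∈ neededSets g k, ∀ p, D.symbol F (d k) W p = D.symbol F' (d k) W p := by
    intro W hWn p
    have hW := neededSets_subset g k hWn
    simp only [neededSets, Finset.mem_filter, Finset.mem_univ, true_and] at hWn
    obtain ⟨hWg, hR⟩ := hWn
    by_cases hkW : k ∈ W
    · rcases ho : D.owner W p with _ | h
      · exact hcache _ W hW hkW p ho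
      · exact hown W hW h (commonRelays_subset hkW (D.owner_mem W hW p h ho)) p ho
    · by_cases ho : ∃ h ∈ commonRelays (insert k W), D.owner W p = some h
      · obtain ⟨h, hh, ho⟩ := ho
        exact hown W hW h (commonRelays_subset (Finset.mem_insert_self _ _) hh) p ho
      · push Not at ho
        set J := insert k W with hJ
        have hkJ : k ∈ J := Finset.mem_insert_self _ _
        have hJW : J.erase k = W := Finset.erase_insert hkW
        have hJg : J.card = g := by rw [hJ, Finset.card_insert_of_notMem hkW, hWg]
        have hb := (D.part_bijOn J k hkJ hJg hR).surjOn
        rw [hJW] at hb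
        -- Bit `p` is the contribution of `k` to position `j` of one multicast message `V^h_J`; the
        -- other summands are to be cancelled.
        obtain ⟨⟨h, j⟩, hh, hp⟩ := hb (show p ∈ {p | _} from ho)
        have hs := hmulti J hJg hkJ h hh j
        rw [← Finset.add_sum_erase _ _ hkJ, ← Finset.add_sum_erase _ _ hkJ, hJW] at hs
        dsimp only at hp
        rw [hp] at hs
        have hrest : ∀ k' ∈ J.erase k, D.symbol F (d k') (J.erase k') (D.part J k' h j) =
            D.symbol F' (d k') (J.erase k') (D.part J k' h j) := by
          intro k' hk'
          rw [Finset.mem_erase] at hk'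
          have hW' : J.erase k' ∈ subfileSets H r g := erase_mem_subfileSets hJg hR hk'.2
          have hkW' : k ∈ J.erase k' := Finset.mem_erase.2 ⟨hk'.1.symm, hkJ⟩
          have hpart : ∀ h' ∈ commonRelays J, D.owner (J.erase k') (D.part J k' h j) ≠ some h' :=
            (D.part_bijOn J k' hk'.2 hJg hR).mapsTo (x := (h, j)) hh
          -- An uncached interfering bit is owned by some `h' ∉ R_J`. As `h' ∈ R_{J \ {k'}}`, it is
          -- not connected to `k'`. It also differs from `h ∈ R_J`, which gives two common relays of
          -- `J \ {k'}`, so (b) applies.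
          rcases ho' : D.owner (J.erase k') (D.part J k' h j) with _ | h'
          · exact hcache _ _ hW' hkW' _ ho'
          · have hh' := D.owner_mem _ hW' _ _ ho'
            have hh'J : h' ∉ commonRelays J := fun hc => hpart h' hc ho'
            refine hcross _ hW' h' (commonRelays_subset hkW' hh') _ ho' k' hkW' ?_ ?_ ?_
            · exact Finset.one_lt_card.2 ⟨h', hh', h,
                commonRelays_anti (Finset.erase_subset _ _) hh, fun hc => hh'J (hc ▸ hh)⟩
            · intro hc
              refine hh'J ?_
              rw [← Finset.insert_erase hk'.2]
              exact mem_commonRelays_insert.2 ⟨hc, hh'⟩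
            · rwa [Finset.insert_erase hk'.2]
        rw [hJW] at hrest
        rw [Finset.sum_congr rfl hrest] at hs
        exact add_right_cancel hs
  have hcard : (neededSets g k).card = (S₁ H r g).toNat := by
    rw [← card_neededSets hg k, Int.toNat_natCast]
  -- The `S₁` needed symbols are just enough for the MDS property.
  refine pieces_injective (D.isMDS.2 ((neededSets g k).subtype (· ∈ subfileSets H r g)) ?_ ?_)
  · rw [Finset.card_subtype, Finset.filter_true_of_mem fun W hW => neededSets_subset g k hW, hcard]
  · funext ⟨⟨W, hW⟩, hWT⟩ p
    have := hneeded W (Finset.mem_subtype.1 hWT) p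
    rwa [symbol, symbol, dif_pos hW, dif_pos hW] at this

/-- The number of bits of the symbols of a file that relay `h` caches. -/
theorem natCard_owned (D : Design H r g L c) (hg : 1 ≤ g) (hr : 1 ≤ r) (h : Fin H) :
    (Nat.card {x : Finset (User H r) × Fin L //
      x.1 ∈ subfileSets H r g ∧ D.owner x.1 x.2 = some h} : ℝ) =
      binom (numUsers H r 1) ((g : ℤ) - 1) * c := by
  rw [natCard_subtype_prod _ ((subfileSets H r g).filter fun W => h ∈ commonRelays W)
    (fun W p => D.owner W p = some h) fun W p => ?_]
  · rw [Finset.sum_congr rfl fun W hW =>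
      D.natCard_owner_some (Finset.mem_filter.1 hW).1 (Finset.mem_filter.1 hW).2,
      Finset.sum_const, smul_eq_mul, Nat.cast_mul, card_filter_subfileSets hg hr]
  · rw [Finset.mem_filter]
    exact ⟨fun hx => ⟨⟨hx.1, D.owner_mem W hx.1 p h hx.2⟩, hx.2⟩, fun hx => ⟨hx.1.1, hx.2⟩⟩

theorem natCard_relayIdx (D : Design H r g L c) (hg : 1 ≤ g) (hr : 1 ≤ r) (N : ℕ) (h : Fin H) :
    (Nat.card ((D.code N).RelayIdx h) : ℝ) = N * (binom (numUsers H r 1) ((g : ℤ) - 1) * c) := by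
  have h0 : Nat.card ((D.code N).RelayIdx h) = ∑ _i : Fin N,
      Nat.card {x : Finset (User H r) × Fin L //
        x.1 ∈ subfileSets H r g ∧ D.owner x.1 x.2 = some h} :=
    natCard_subtype_prod _ _ (fun _ (x : Finset (User H r) × Fin L) =>
        x.1 ∈ subfileSets H r g ∧ D.owner x.1 x.2 = some h) fun _ _ => by simp
  rw [h0, Finset.sum_const, Finset.card_univ, Fintype.card_fin, smul_eq_mul, Nat.cast_mul,
    D.natCard_owned hg hr h]

theorem natCard_userIdx (D : Design H r g L c) (hg : 1 ≤ g) (N : ℕ) (k : User H r) :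
    (Nat.card ((D.code N).UserIdx k) : ℝ) =
      N * (S₂ H r g * L - r * binom (numUsers H r 1 - 1) ((g : ℤ) - 2) * c) := by
  have h0 : Nat.card ((D.code N).UserIdx k) = ∑ _i : Fin N,
      Nat.card {x : Finset (User H r) × Fin L //
        x.1 ∈ subfileSets H r g ∧ k ∈ x.1 ∧ D.owner x.1 x.2 = none} :=
    natCard_subtype_prod _ _ (fun _ (x : Finset (User H r) × Fin L) =>
        x.1 ∈ subfileSets H r g ∧ k ∈ x.1 ∧ D.owner x.1 x.2 = none) fun _ _ => by simp
  rw [h0, Finset.sum_const, Finset.card_univ, Fintype.card_fin, smul_eq_mul, Nat.cast_mul,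
    natCard_subtype_prod _ ((subfileSets H r g).filter fun W => k ∈ W)
    (fun W p => D.owner W p = none) fun W p => by rw [Finset.mem_filter, and_assoc]]
  have h1 : ∀ W ∈ (subfileSets H r g).filter fun W => k ∈ W,
      (Nat.card {p // D.owner W p = none} : ℝ) = L - (commonRelays W).card * c := by
    intro W hW
    rw [eq_sub_iff_add_eq]
    exact_mod_cast D.natCard_owner_none (Finset.mem_filter.1 hW).1
  rw [Nat.cast_sum, Finset.sum_congr rfl h1, Finset.sum_sub_distrib, Finset.sum_const,
    nsmul_eq_mul, ← Finset.sum_mul, ← Nat.cast_sum]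
  have h2 : (((subfileSets H r g).filter fun W => k ∈ W).card : ℝ) = S₂ H r g := by
    exact_mod_cast card_filter_mem_subfileSets hg k
  have h3 : ((∑ W ∈ (subfileSets H r g).filter (fun W => k ∈ W), (commonRelays W).card : ℕ) : ℝ) =
      r * binom (numUsers H r 1 - 1) ((g : ℤ) - 2) := by
    exact_mod_cast sum_card_commonRelays hg k
  rw [h2, h3]

theorem natCard_txIdx (D : Design H r g L c) (hg : 1 ≤ g) (hr : 1 ≤ r) (N : ℕ)
    (d : Demand H r N) (h : Fin H) :
    (Nat.card ((D.code N).TxIdx d h) : ℝ) =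
      L * ((subfileSets H r (g + 1)).card / H) - binom (numUsers H r 1) g * c := by
  have h0 : Nat.card ((D.code N).TxIdx d h) =
      ∑ J ∈ (subfileSets H r (g + 1)).filter fun J => h ∈ commonRelays J, partLen L c J := by
    refine (natCard_sigma_fin (fun J : Finset (User H r) => J.card = g ∧ h ∈ commonRelays J)
      (partLen L c)).trans (Finset.sum_congr ?_ fun _ _ => rfl)
    ext J
    simp only [subfileSets, Finset.mem_filter, Finset.mem_univ, true_and, Nat.add_right_cancel_iff]
    exact ⟨fun hJ => ⟨⟨hJ.1, h, hJ.2⟩, hJ.2⟩, fun hJ => ⟨hJ.1.1, hJ.2⟩⟩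
  have h1 : (((subfileSets H r (g + 1)).filter fun J => h ∈ commonRelays J).card : ℝ) =
      binom (numUsers H r 1) g := by
    rw [card_filter_subfileSets (by omega) hr]
    simp
  rw [h0, D.sum_partLen hg _ _ h, share_subfileSets, h1]
  intro J hJ
  simpa using (Finset.mem_filter.1 hJ).2.1

theorem natCard_fwdIdx (D : Design H r g L c) (hg : 1 ≤ g) (N : ℕ)
    (d : Demand H r N) (k : User H r) (h : k.1) :
    (Nat.card ((D.code N).FwdIdx d k h) : ℝ) =
      binom (numUsers H r 1) ((g : ℤ) - 1) * c + ((crossPairs g k h.1).card * c +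
        (L * ((S₁ H r g - S₂ H r g) / r) - binom (numUsers H r 1 - 1) ((g : ℤ) - 1) * c)) := by
  have hr : 1 ≤ r := by rw [← k.2]; exact Finset.card_pos.2 ⟨h.1, h.2⟩
  have h0 : Nat.card ((D.code N).FwdIdx d k h) =
      Nat.card {x : Finset (User H r) × Fin L //
        x.1 ∈ subfileSets H r g ∧ D.owner x.1 x.2 = some h.1} +
      (Nat.card {x : User H r × Finset (User H r) × Fin L //
        x.2.1 ∈ subfileSets H r g ∧ D.owner x.2.1 x.2.2 = some h.1 ∧ k ∈ x.2.1 ∧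
        1 < (commonRelays x.2.1).card ∧ h.1 ∉ x.1.1 ∧
        (commonRelays (insert x.1 x.2.1)).Nonempty} +
      Nat.card ((J : {J : Finset (User H r) // (J.card = g ∧ h.1 ∈ commonRelays J) ∧ k ∈ J}) ×
        Fin (partLen L c J.1))) := by
    rw [← Nat.card_sum, ← Nat.card_sum]
    rfl
  rw [h0, Nat.cast_add, Nat.cast_add, D.natCard_owned hg hr]
  congr 2
  · rw [natCard_subtype_prod_prod _ (crossPairs g k h.1) (fun _ W p => D.owner W p = some h.1)]
    · rw [Finset.sum_congr rfl fun y hy => D.natCard_owner_some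
        (Finset.mem_filter.1 hy).2.1.1 (Finset.mem_filter.1 hy).2.1.2, Finset.sum_const,
        smul_eq_mul, Nat.cast_mul]
    · intro k' W p
      simp only [crossPairs, Finset.mem_filter, Finset.mem_univ, true_and]
      constructor
      · rintro ⟨h1, h2, h3⟩
        exact ⟨⟨⟨h1, D.owner_mem W h1 p _ h2⟩, h3⟩, h2⟩
      · rintro ⟨⟨⟨h1, _⟩, h3⟩, h2⟩
        exact ⟨h1, h2, h3⟩
  · have h1 : (Finset.univ.filter fun J : Finset (User H r) =>
        (J.card = g ∧ h.1 ∈ commonRelays J) ∧ k ∈ J) =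
        (multicastSets g k).filter fun J => h.1 ∈ commonRelays J := by
      ext J
      simp only [multicastSets, Finset.mem_filter, Finset.mem_univ, true_and]
      exact ⟨fun hJ => ⟨⟨⟨hJ.1.1, h.1, hJ.1.2⟩, hJ.2⟩, hJ.1.2⟩,
        fun hJ => ⟨⟨hJ.1.1.1, hJ.2⟩, hJ.1.2⟩⟩
    have h2 := card_filter_subset_commonRelays_mem g k (Finset.singleton_subset_iff.2 h.2)
    simp only [Finset.singleton_subset_iff, Finset.card_singleton] at h2
    rw [h1] at h2
    have h3 : ((multicastSets g k).card : ℝ) = S₁ H r g - S₂ H r g := by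
      exact_mod_cast card_multicastSets hg k
    have h4 : (((multicastSets g k).filter fun J => h.1 ∈ commonRelays J).card : ℝ) =
        binom (numUsers H r 1 - 1) ((g : ℤ) - 1) := by exact_mod_cast h2
    rw [natCard_sigma_fin (fun J : Finset (User H r) => (J.card = g ∧ h.1 ∈ commonRelays J) ∧ k ∈ J)
      (partLen L c), h1, D.sum_partLen hg _ _ h.1, share_multicastSets g k h.2, h3, h4]
    intro J hJ
    exact (Finset.mem_filter.1 hJ).2.1.1

end Design

/-! ### Relations between the parameters -/

section Parameters

variable {H r : ℕ}

theorem exists_user (hrH : r ≤ H) : Nonempty (User H r) := by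
  obtain ⟨s, -, hs⟩ := Finset.exists_subset_card_eq (s := (Finset.univ : Finset (Fin H))) (n := r)
    (by simpa using hrH)
  exact ⟨⟨s, hs⟩⟩

theorem neededSets_nonempty (hr : 1 ≤ r) {g : ℕ} (hg : 1 ≤ g)
    (hgK : (g : ℤ) - 1 ≤ numUsers H r 1) (k : User H r) : (neededSets g k).Nonempty := by
  obtain ⟨h, hh⟩ : k.1.Nonempty := Finset.card_pos.1 (by rw [k.2]; exact hr)
  have h1 := card_usersOf (H := H) (r := r) (A := {h}) (by simpa using hr)
  rw [Finset.card_singleton] at h1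
  obtain ⟨W, hW, hWc⟩ := Finset.exists_subset_card_eq (s := usersOf H r {h}) (n := g - 1)
    (by omega)
  refine ⟨W, ?_⟩
  simp only [neededSets, Finset.mem_filter, Finset.mem_univ, true_and]
  exact ⟨by omega, h, mem_commonRelays_insert.2 ⟨hh, mem_commonRelays_iff_subset.2 hW⟩⟩

theorem S₁_pos (hr : 1 ≤ r) (hrH : r ≤ H) {g : ℕ} (hg : 1 ≤ g)
    (hgK : (g : ℤ) - 1 ≤ numUsers H r 1) : 0 < S₁ H r g := by
  obtain ⟨k⟩ := exists_user hrH
  rw [← card_neededSets hg k, Nat.cast_pos]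
  exact Finset.card_pos.2 (neededSets_nonempty hr hg hgK k)

/-- All users in `W` are connected to all of `R_W`, so `K_{|R_W|} ≥ |W| ≥ g - 1`, and `|R_W|`
competes in the maximum defining `y*`. Nonemptiness of `W` ensures `|R_W| ≤ r`. -/
theorem card_commonRelays_le_yStar {g : ℕ} {W : Finset (User H r)} (hW : W.Nonempty)
    (hg : g ≤ W.card + 1) : (commonRelays W).card ≤ yStar H r g := by
  obtain ⟨k, hk⟩ := hW
  have h1 : (commonRelays W).card ≤ r :=
    (Finset.card_le_card (commonRelays_subset hk)).trans_eq k.2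
  rcases Nat.eq_zero_or_pos (commonRelays W).card with h0 | h0
  · rw [h0]
    exact Nat.zero_le _
  · refine Finset.le_sup (f := id) (Finset.mem_filter.2 ⟨Finset.mem_Icc.2 ⟨h0, h1⟩, ?_⟩)
    change (g : ℤ) - 1 ≤ numUsers H r (commonRelays W).card
    rw [← card_usersOf h1]
    have := Finset.card_le_card (subset_commonRelays_iff.1 (subset_refl (commonRelays W)))
    omega

/-- Pascal's rule, with `K_2 = 0` by convention when `r = 1`. It turns the range `g ≤ K_2 + 1` into
`g - 1 ≤ K_1`, which makes `S₁` and `y*` positive. -/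
theorem numUsers_two_le (hr : 1 ≤ r) (hrH : r ≤ H) : numUsers H r 2 ≤ numUsers H r 1 := by
  rcases hr.eq_or_lt with rfl | hr2
  · exact le_trans (by simp [numUsers, binom]) (numUsers_nonneg _ _ _)
  · obtain ⟨r, rfl⟩ := Nat.exists_eq_add_of_le hr2
    obtain ⟨H, rfl⟩ := Nat.exists_eq_add_of_le ((Nat.le_add_right _ r).trans hrH)
    have h1 : numUsers (1 + 1 + H) (1 + 1 + r) 2 = H.choose r := by
      rw [numUsers, ← binom_natCast]
      congr 1 <;> push_cast <;> ring
    have h2 : numUsers (1 + 1 + H) (1 + 1 + r) 1 = (H + 1).choose (r + 1) := by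
      rw [numUsers, ← binom_natCast]
      congr 1 <;> push_cast <;> ring
    have h3 : (H + 1).choose (r + 1) = H.choose r + H.choose (r + 1) := Nat.choose_succ_succ H r
    rw [h1, h2]
    exact_mod_cast (by omega)

theorem yStar_pos (hr : 1 ≤ r) (hrH : r ≤ H) {g : ℕ} (hg : 2 ≤ g)
    (hgK : (g : ℤ) - 1 ≤ numUsers H r 1) : 0 < yStar H r g := by
  obtain ⟨k⟩ := exists_user hrH
  obtain ⟨W, hW⟩ := neededSets_nonempty hr (by omega) hgK k
  have hW' := neededSets_subset g k hW
  simp only [subfileSets, Finset.mem_filter, Finset.mem_univ, true_and] at hW'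
  exact (Finset.card_pos.2 hW'.2).trans_le
    (card_commonRelays_le_yStar (Finset.card_pos.1 (by omega)) hW'.1.ge)

theorem binom_numUsers_pascal (hr : 1 ≤ r) (hrH : r ≤ H) {g : ℕ} (hg : 2 ≤ g) :
    binom (numUsers H r 1) ((g : ℤ) - 1) =
      binom (numUsers H r 1 - 1) ((g : ℤ) - 2) + binom (numUsers H r 1 - 1) ((g : ℤ) - 1) := by
  obtain ⟨n, hn⟩ : ∃ n : ℕ, numUsers H r 1 = n + 1 :=
    ⟨(numUsers H r 1 - 1).toNat, by have := numUsers_pos hr hrH; omega⟩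
  obtain ⟨g, rfl⟩ := Nat.exists_eq_add_of_le hg
  rw [hn, add_sub_cancel_right, show ((2 + g : ℕ) : ℤ) - 1 = (g + 1 : ℕ) by push_cast; ring,
    show ((2 + g : ℕ) : ℤ) - 2 = (g : ℕ) by push_cast; ring, ← Nat.cast_succ, binom_natCast,
    binom_natCast, binom_natCast, Nat.choose_succ_succ, Nat.cast_add]

theorem numUsers_one_mul_binom (hr : 1 ≤ r) (hrH : r ≤ H) {g : ℕ} (hg : 1 ≤ g) :
    numUsers H r 1 * binom (numUsers H r 1 - 1) ((g : ℤ) - 1) = g * binom (numUsers H r 1) g := by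
  obtain ⟨n, hn⟩ : ∃ n : ℕ, numUsers H r 1 = n + 1 :=
    ⟨(numUsers H r 1 - 1).toNat, by have := numUsers_pos hr hrH; omega⟩
  obtain ⟨g, rfl⟩ := Nat.exists_eq_add_of_le' hg
  rw [hn, add_sub_cancel_right, Nat.cast_succ, add_sub_cancel_right, ← Nat.cast_succ n,
    ← Nat.cast_succ g, binom_natCast, binom_natCast, mul_comm ((g.succ : ℕ) : ℤ)]
  exact_mod_cast Nat.add_one_mul_choose_eq n g

theorem numUsers_zero_mul_self (hr : 1 ≤ r) (hrH : r ≤ H) :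
    numUsers H r 0 * r = H * numUsers H r 1 := by
  obtain ⟨r, rfl⟩ := Nat.exists_eq_add_of_le' hr
  obtain ⟨H, rfl⟩ := Nat.exists_eq_add_of_le' (hr.trans hrH)
  have h1 : numUsers (H + 1) (r + 1) 0 = (H + 1).choose (r + 1) := by
    rw [numUsers, ← binom_natCast]
    congr 1
  have h2 : numUsers (H + 1) (r + 1) 1 = H.choose r := by
    rw [numUsers, ← binom_natCast]
    congr 1 <;> push_cast <;> ring
  rw [h1, h2]
  exact_mod_cast (Nat.add_one_mul_choose_eq H r).symm

/-- The left side is the sum of `|R_J|` over the `S₁ - S₂` multicast sets of a user, and each term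
is at most `y*`. This shows that the maximum with `0` in the server load is inactive. -/
theorem mul_binom_le_yStar_mul (hrH : r ≤ H) {g : ℕ} (hg : 1 ≤ g) :
    r * binom (numUsers H r 1 - 1) ((g : ℤ) - 1) ≤ yStar H r g * (S₁ H r g - S₂ H r g) := by
  obtain ⟨k⟩ := exists_user hrH
  have h1 := sum_card_commonRelays (g := g + 1) (by omega) k
  rw [show ((g + 1 : ℕ) : ℤ) - 2 = g - 1 by push_cast; ring] at h1
  have h2 : (subfileSets H r (g + 1)).filter (fun W => k ∈ W) = multicastSets g k := by
    ext J
    simp [subfileSets, multicastSets]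
  rw [← h1, ← card_multicastSets hg k, h2, mul_comm, ← Nat.cast_mul, Nat.cast_le, ← smul_eq_mul]
  refine Finset.sum_le_card_nsmul _ _ _ fun J hJ => ?_
  simp only [multicastSets, Finset.mem_filter] at hJ
  exact card_commonRelays_le_yStar ⟨k, hJ.2.2⟩ (by omega)

end Parameters

/-! ### The corner points -/

namespace Design

variable {H r g L c N : ℕ}

theorem attains_endUserPoint (hr : 1 ≤ r) (hrH : r ≤ H) (hN : 1 ≤ N) (hg : 1 ≤ g)
    (hgK : (g : ℤ) ≤ numUsers H r 1) (D : Design H r g L 0) :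
    (D.code N).Attains (endUserPoint H r N g) := by
  have hS := S₁_pos hr hrH hg (by omega)
  have hB : (((S₁ H r g).toNat * L : ℕ) : ℝ) = S₁ H r g * L := by
    rw [Nat.cast_mul, ← Int.cast_natCast (S₁ H r g).toNat, Int.toNat_of_nonneg hS.le]
  have hS' : (S₁ H r g : ℝ) ≠ 0 := by exact_mod_cast hS.ne'
  have hN' : (N : ℝ) ≠ 0 := by exact_mod_cast (by omega : N ≠ 0)
  have hr' : (r : ℝ) ≠ 0 := by exact_mod_cast (by omega : r ≠ 0)
  have hH' : (H : ℝ) ≠ 0 := by exact_mod_cast (by omega : H ≠ 0)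
  have hg' : (g : ℝ) ≠ 0 := by exact_mod_cast (by omega : g ≠ 0)
  refine ⟨fun h => ?_, fun k => ?_, fun d => ⟨fun h => ?_, fun k h => ?_, D.recovers hg N d⟩⟩
  · rw [D.natCard_relayIdx hg hr]
    simp [endUserPoint]
  · rw [D.natCard_userIdx hg, hB]
    simp only [endUserPoint]
    field_simp
    push_cast
    ring
  · have hK : (numUsers H r 0 : ℝ) * (S₁ H r g - S₂ H r g) = g * (subfileSets H r (g + 1)).card := by
      exact_mod_cast numUsers_zero_mul hg
    rw [D.natCard_txIdx hg hr, hB]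
    simp only [endUserPoint]
    field_simp
    push_cast
    linear_combination -L * hK
  · rw [D.natCard_fwdIdx hg, hB]
    simp only [endUserPoint]
    field_simp
    push_cast
    ring

theorem attains_relayUserPoint (hr : 1 ≤ r) (hrH : r ≤ H) (hN : 1 ≤ N) (hg : 2 ≤ g)
    (hgK : (g : ℤ) ≤ numUsers H r 2 + 1) (D : Design H r g (yStar H r g * c) c) :
    (D.code N).Attains (relayUserPoint H r N g) := by
  have hgK' : (g : ℤ) - 1 ≤ numUsers H r 1 := by
    have := numUsers_two_le hr hrH
    omega
  have hg1 : 1 ≤ g := by omega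
  have hS := S₁_pos hr hrH hg1 hgK'
  have hB : (((S₁ H r g).toNat * (yStar H r g * c) : ℕ) : ℝ) = S₁ H r g * (yStar H r g * c) := by
    rw [Nat.cast_mul, ← Int.cast_natCast (S₁ H r g).toNat, Int.toNat_of_nonneg hS.le, Nat.cast_mul]
  have hS' : (S₁ H r g : ℝ) ≠ 0 := by exact_mod_cast hS.ne'
  have hy' : (yStar H r g : ℝ) ≠ 0 := by exact_mod_cast (yStar_pos hr hrH hg hgK').ne'
  have hN' : (N : ℝ) ≠ 0 := by exact_mod_cast (by omega : N ≠ 0)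
  have hr' : (r : ℝ) ≠ 0 := by exact_mod_cast (by omega : r ≠ 0)
  have hH' : (H : ℝ) ≠ 0 := by exact_mod_cast (by omega : H ≠ 0)
  have hg' : (g : ℝ) ≠ 0 := by exact_mod_cast (by omega : g ≠ 0)
  have hP : (binom (numUsers H r 1) ((g : ℤ) - 1) : ℝ) =
      binom (numUsers H r 1 - 1) ((g : ℤ) - 2) + binom (numUsers H r 1 - 1) ((g : ℤ) - 1) := by
    exact_mod_cast binom_numUsers_pascal hr hrH hg
  refine ⟨fun h => ?_, fun k => ?_, fun d => ⟨fun h => ?_, fun k h => ?_, D.recovers hg1 N d⟩⟩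
  · rw [D.natCard_relayIdx hg1 hr, hB]
    simp only [relayUserPoint, relayMem]
    field_simp
  · rw [D.natCard_userIdx hg1, hB]
    simp only [relayUserPoint, userMem]
    field_simp
    push_cast
    ring
  · have hK : (numUsers H r 0 : ℝ) * (S₁ H r g - S₂ H r g) = g * (subfileSets H r (g + 1)).card := by
      exact_mod_cast numUsers_zero_mul hg1
    have hK1 : (numUsers H r 1 : ℝ) * binom (numUsers H r 1 - 1) ((g : ℤ) - 1) =
        g * binom (numUsers H r 1) g := by
      exact_mod_cast numUsers_one_mul_binom hr hrH hg1
    have hK0 : (numUsers H r 0 : ℝ) * r = H * numUsers H r 1 := by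
      exact_mod_cast numUsers_zero_mul_self hr hrH
    have hle : (r : ℝ) * binom (numUsers H r 1 - 1) ((g : ℤ) - 1) ≤
        yStar H r g * (S₁ H r g - S₂ H r g) := by
      exact_mod_cast mul_binom_le_yStar_mul hrH hg1
    -- Pascal's rule merges the relay and user memories into a numerator whose sign is settled by
    -- `hle`.
    have hM : 1 - (r * relayMem H r N g + userMem H r N g) / N =
        (yStar H r g * (S₁ H r g - S₂ H r g) - r * binom (numUsers H r 1 - 1) ((g : ℤ) - 1)) /
          (yStar H r g * S₁ H r g) := by
      simp only [relayMem, userMem]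
      rw [hP]
      field_simp
      ring
    have hS0 : (0 : ℝ) ≤ S₁ H r g := by exact_mod_cast hS.le
    rw [D.natCard_txIdx hg1 hr, hB]
    simp only [relayUserPoint]
    rw [hM, max_eq_left (div_nonneg (sub_nonneg.2 hle) (mul_nonneg (Nat.cast_nonneg _) hS0))]
    field_simp
    push_cast
    -- `hK` matches the terms in `L`. For the terms in `c`, `K r = H K_1` and the absorption
    -- identity for `binom K_1 g` turn the average per user into the count per relay.
    linear_combination (-c * yStar H r g : ℝ) * hK +
      c * binom (numUsers H r 1 - 1) ((g : ℤ) - 1) * hK0 + c * H * hK1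
  · have hX : ((crossPairs g k h.1).card : ℝ) =
        ((∑ b ∈ Finset.Icc 2 r, binom ((r : ℤ) - 1) ((b : ℤ) - 1) *
          binom (numUsers H r b - 1) ((g : ℤ) - 2) *
          (numUsers H r (b - 1) - numUsers H r b) * (-1) ^ b : ℤ) : ℝ) := by
      exact_mod_cast card_crossPairs hg k h.2
    rw [D.natCard_fwdIdx hg1, hB, hP, hX]
    simp only [relayUserPoint, userMem]
    field_simp
    push_cast
    ring

end Design

/-! ## Existence of MDS codes and of designs -/

/-- Reed-Solomon codes over the field with `2 ^ L` elements. -/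
theorem exists_isMDS {ι : Type} [Finite ι] {s L : ℕ} (hs : s ≤ Nat.card ι) (hL : L ≠ 0)
    (hι : Nat.card ι ≤ 2 ^ L) :
    ∃ enc : (Fin s → Fin L → ZMod 2) → ι → Fin L → ZMod 2, IsMDS enc := by
  classical
  have hF := GaloisField.card 2 L hL
  have : Finite (GaloisField 2 L) := Nat.finite_of_card_ne_zero (by rw [hF]; positivity)
  have := Fintype.ofFinite (GaloisField 2 L)
  have := Fintype.ofFinite ι
  -- A mere bijection of sets suffices, since the MDS property only asks for injectivity.
  obtain ⟨e⟩ : Nonempty ((Fin L → ZMod 2) ≃ GaloisField 2 L) := by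
    rw [← Finite.card_eq, hF]
    simp
  obtain ⟨α⟩ : Nonempty (ι ↪ GaloisField 2 L) := by
    refine Function.Embedding.nonempty_of_card_le ?_
    rwa [← Nat.card_eq_fintype_card, ← Nat.card_eq_fintype_card, hF]
  refine ⟨fun m w => e.symm (∑ i : Fin s, α w ^ (i : ℕ) * e (m i)), hs, fun T hT m m' h => ?_⟩
  let t : Fin s ≃ T := (Finset.equivFinOfCardEq hT).symm
  -- The selected symbols are values of a polynomial with `s` coefficients at `s` distinct points.
  have hdet : (Matrix.vandermonde fun j => α (t j)).det ≠ 0 :=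
    Matrix.det_vandermonde_ne_zero_iff.2
      (α.injective.comp (Subtype.val_injective.comp t.injective))
  have hzero := Matrix.eq_zero_of_mulVec_eq_zero (v := fun i => e (m i) - e (m' i)) hdet (by
    funext j
    have := e.symm.injective (congrFun h (t j))
    simp only [Matrix.mulVec, dotProduct, Matrix.vandermonde_apply, mul_sub,
      Finset.sum_sub_distrib, Pi.zero_apply]
    rw [this, sub_self])
  funext i
  exact e.injective (sub_eq_zero.1 (congrFun hzero i))

/-- Embed `A × Fin c` into the positions and label each image by its first coordinate. -/
theorem exists_owner {H L c : ℕ} (A : Finset (Fin H)) (hA : A.card * c ≤ L) :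
    ∃ o : Fin L → Option (Fin H), (∀ p h, o p = some h → h ∈ A) ∧
      ∀ h ∈ A, (Finset.univ.filter fun p => o p = some h).card = c := by
  classical
  obtain ⟨f⟩ : Nonempty (A × Fin c ↪ Fin L) :=
    Function.Embedding.nonempty_of_card_le (by simpa using hA)
  have ho : ∀ p h, (if hp : ∃ x, f x = p then some hp.choose.1.1 else none) = some h ↔
      ∃ (hh : h ∈ A) (j : Fin c), f (⟨h, hh⟩, j) = p := by
    intro p h
    constructor
    · intro hp
      split_ifs at hp with hx
      obtain rfl := Option.some.inj hp
      exact ⟨hx.choose.1.2, hx.choose.2, hx.choose_spec⟩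
    · rintro ⟨hh, j, rfl⟩
      have hx : ∃ x, f x = f (⟨h, hh⟩, j) := ⟨_, rfl⟩
      rw [dif_pos hx, f.injective hx.choose_spec]
  refine ⟨fun p => if hp : ∃ x, f x = p then some hp.choose.1.1 else none,
    fun p h hp => ((ho p h).1 hp).1, fun h hh => ?_⟩
  have : (Finset.univ.filter fun p =>
      (if hp : ∃ x, f x = p then some hp.choose.1.1 else none) = some h) =
      Finset.univ.image fun j : Fin c => f (⟨h, hh⟩, j) := by
    ext p
    rw [Finset.mem_filter, ho]
    simp [hh]
  rw [this, Finset.card_image_of_injective, Finset.card_univ, Fintype.card_fin]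
  intro j j' hj
  exact (Prod.ext_iff.1 (f.injective hj)).2

/-- `hZ` gives enough field elements for the MDS code, and `hc` gives room for the cached parts. By
`hdvd`, every `|R_J| ≤ H` divides `L`, so the uncached bits split evenly. -/
theorem exists_design {H r g L c : ℕ} (hrH : r ≤ H) (hg : 1 ≤ g) (hL : L ≠ 0)
    (hZ : (subfileSets H r g).card ≤ 2 ^ L) (hdvd : H.factorial ∣ L)
    (hc : ∀ W ∈ subfileSets H r g, (commonRelays W).card * c ≤ L) :
    Nonempty (Design H r g L c) := by
  obtain ⟨k⟩ := exists_user hrH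
  have hs : (S₁ H r g).toNat ≤ (subfileSets H r g).card := by
    rw [← card_neededSets hg k, Int.toNat_natCast]
    exact Finset.card_le_card (neededSets_subset g k)
  obtain ⟨enc, henc⟩ := exists_isMDS (ι := subfileSets H r g) (s := (S₁ H r g).toNat) (L := L)
    (by rwa [Nat.card_eq_fintype_card, Fintype.card_coe]) hL
    (by rwa [Nat.card_eq_fintype_card, Fintype.card_coe])
  have howner : ∀ W : Finset (User H r), ∃ o : Fin L → Option (Fin H), W ∈ subfileSets H r g →
      (∀ p h, o p = some h → h ∈ commonRelays W) ∧
      ∀ h ∈ commonRelays W, (Finset.univ.filter fun p => o p = some h).card = c := by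
    intro W
    by_cases hW : W ∈ subfileSets H r g
    · obtain ⟨o, ho⟩ := exists_owner (commonRelays W) (hc W hW)
      exact ⟨o, fun _ => ho⟩
    · exact ⟨fun _ => none, fun h => absurd h hW⟩
  choose owner howner using howner
  have hpart : ∀ (J : Finset (User H r)) (k : User H r),
      ∃ part : Fin H × Fin (partLen L c J) → Fin L,
      k ∈ J → J.card = g → (commonRelays J).Nonempty →
      Set.BijOn part {x | x.1 ∈ commonRelays J}
        {p | ∀ h ∈ commonRelays J, owner (J.erase k) p ≠ some h} := by
    intro J k
    have : Nonempty (Fin L) := ⟨⟨0, Nat.pos_of_ne_zero hL⟩⟩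
    by_cases hJ : k ∈ J ∧ J.card = g ∧ (commonRelays J).Nonempty
    · obtain ⟨hk, hJg, hR⟩ := hJ
      have hW := Design.erase_mem_subfileSets hJg hR hk
      have hcard := card_filter_ne_some (c := c) (owner (J.erase k)) (commonRelays J)
        fun h hh => (howner _ hW).2 h (commonRelays_anti (Finset.erase_subset k J) hh)
      have hRdvd : (commonRelays J).card ∣ L := by
        refine (Nat.dvd_factorial (Finset.card_pos.2 hR) ?_).trans hdvd
        simpa using (commonRelays J).card_le_univ
      have hlen : (commonRelays J).card * partLen L c J = L - (commonRelays J).card * c :=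
        Nat.mul_div_cancel' (Nat.dvd_sub hRdvd (Dvd.intro _ rfl))
      have hset : {x : Fin H × Fin (partLen L c J) | x.1 ∈ commonRelays J} =
          ((commonRelays J ×ˢ Finset.univ : Finset (Fin H × Fin (partLen L c J))) : Set _) := by
        ext x
        simp
      have hset' : {p | ∀ h ∈ commonRelays J, owner (J.erase k) p ≠ some h} =
          ((Finset.univ.filter fun p => ∀ h ∈ commonRelays J,
            owner (J.erase k) p ≠ some h : Finset (Fin L)) : Set _) := by
        ext p
        simp
      obtain ⟨f, hf⟩ := (Set.toFinite {x : Fin H × Fin (partLen L c J) |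
        x.1 ∈ commonRelays J}).exists_bijOn_of_encard_eq
        (t := {p | ∀ h ∈ commonRelays J, owner (J.erase k) p ≠ some h}) (by
          rw [hset, hset', Set.encard_coe_eq_coe_finsetCard, Set.encard_coe_eq_coe_finsetCard,
            Finset.card_product, Finset.card_univ, Fintype.card_fin, hlen, Nat.cast_inj]
          omega)
      exact ⟨f, fun _ _ _ => hf⟩
    · exact ⟨fun _ => this.some, fun h1 h2 h3 => absurd ⟨h1, h2, h3⟩ hJ⟩
  choose part hpart using hpart
  exact ⟨{
    enc := enc
    isMDS := henc
    owner := owner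
    owner_mem := fun W hW => (howner W hW).1
    owner_card := fun W hW => (howner W hW).2
    part := fun J k h j => part J k (h, j)
    part_bijOn := fun J k hk hJ hR => hpart J k hk hJ hR }⟩

theorem exists_endUser_designs {H r g : ℕ} (hrH : r ≤ H) (hg : 1 ≤ g) :
    ∃ b : ℕ, 0 < b ∧ ∀ n : ℕ, 0 < n → Nonempty (Design H r g (n * b) 0) := by
  have hH := Nat.factorial_pos H
  -- The factorial gives divisibility; the second factor makes `L ≥ |Z_g|`, and then `L < 2 ^ L`
  -- leaves enough field elements.
  refine ⟨H.factorial * ((subfileSets H r g).card + 1), by positivity, fun n hn => ?_⟩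
  refine exists_design hrH hg (by positivity) ?_ ?_ (by simp)
  · refine le_trans ?_ Nat.lt_two_pow_self.le
    calc (subfileSets H r g).card ≤ 1 * (1 * ((subfileSets H r g).card + 1)) := by omega
      _ ≤ n * (H.factorial * ((subfileSets H r g).card + 1)) := by gcongr <;> omega
  · exact (Dvd.intro _ rfl).mul_left n

theorem exists_relayUser_designs {H r g : ℕ} (hr : 1 ≤ r) (hrH : r ≤ H) (hg : 2 ≤ g)
    (hgK : (g : ℤ) ≤ numUsers H r 2 + 1) :
    ∃ b : ℕ, 0 < b ∧ ∀ n : ℕ, 0 < n →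
      Nonempty (Design H r g (yStar H r g * (n * b)) (n * b)) := by
  have hy := yStar_pos hr hrH hg (by have := numUsers_two_le hr hrH; omega)
  have hH := Nat.factorial_pos H
  refine ⟨H.factorial * ((subfileSets H r g).card + 1), by positivity, fun n hn => ?_⟩
  refine exists_design hrH (by omega) (by positivity) ?_ ?_ ?_
  · refine le_trans ?_ Nat.lt_two_pow_self.le
    calc (subfileSets H r g).card ≤ 1 * (1 * (1 * ((subfileSets H r g).card + 1))) := by omega
      _ ≤ yStar H r g * (n * (H.factorial * ((subfileSets H r g).card + 1))) := by
        gcongr <;> omega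
  · exact ((Dvd.intro _ rfl).mul_left n).mul_left _
  · intro W hW
    simp only [subfileSets, Finset.mem_filter, Finset.mem_univ, true_and] at hW
    exact Nat.mul_le_mul_right _
      (card_commonRelays_le_yStar (Finset.card_pos.1 (by omega)) hW.1.ge)

/-! ## Relays that cache MDS symbols -/

namespace RelayDesign

variable {H r L N : ℕ}

theorem exists_relayDesigns (hrH : r ≤ H) (hr : 1 ≤ r) :
    ∃ b : ℕ, 0 < b ∧ ∀ n : ℕ, 0 < n → Nonempty (RelayDesign H r (n * b)) := by
  have hH : 0 < H := by omega
  refine ⟨H, hH, fun n hn => ?_⟩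
  obtain ⟨enc, henc⟩ := exists_isMDS (ι := Fin H) (s := r) (L := n * H) (by simpa using hrH)
    (by positivity) (by
      rw [Nat.card_eq_fintype_card, Fintype.card_fin]
      exact le_trans (Nat.le_mul_of_pos_left H hn) Nat.lt_two_pow_self.le)
  exact ⟨⟨enc, henc⟩⟩

theorem attains_relayPoint (hr : 1 ≤ r) (D : RelayDesign H r L) :
    (D.code N).Attains (relayPoint r N) := by
  have hr' : (r : ℝ) ≠ 0 := by exact_mod_cast (by omega : r ≠ 0)
  refine ⟨fun h => ?_, fun k => ?_, fun d => ⟨fun h => ?_, fun k h => ?_, ?_⟩⟩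
  · change (Nat.card (Fin N × Fin L) : ℝ) = (N : ℝ) / r * (r * L : ℕ)
    simp only [Nat.card_eq_fintype_card, Fintype.card_prod, Fintype.card_fin, Nat.cast_mul]
    field_simp
  · change (Nat.card Empty : ℝ) = 0 * (r * L : ℕ)
    simp
  · change (Nat.card Empty : ℝ) = 0 * (r * L : ℕ)
    simp
  · change (Nat.card (Fin L) : ℝ) = 1 / (r : ℝ) * (r * L : ℕ)
    simp only [Nat.card_eq_fintype_card, Fintype.card_fin, Nat.cast_mul]
    field_simp
  -- The relays of `k` are themselves a set of exactly `r` MDS symbols.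
  · refine Code.recovers_zero _ _ fun k F F' hv => pieces_injective (D.isMDS.2 k.1 k.2 ?_)
    funext h
    exact congrFun (congrArg Prod.snd hv) h

theorem attains_fullPoint (hr : 1 ≤ r) (D : RelayDesign H r L) :
    (D.fullCode N).Attains (fullPoint r N) := by
  have hr' : (r : ℝ) ≠ 0 := by exact_mod_cast (by omega : r ≠ 0)
  refine ⟨fun h => ?_, fun k => ?_, fun d => ⟨fun h => ?_, fun k h => ?_, ?_⟩⟩
  · change (Nat.card (Fin N × Fin L) : ℝ) = (N : ℝ) / r * (r * L : ℕ)
    simp only [Nat.card_eq_fintype_card, Fintype.card_prod, Fintype.card_fin, Nat.cast_mul]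
    field_simp
  · change (Nat.card (Fin N × Fin (r * L)) : ℝ) = N * (r * L : ℕ)
    simp
  · change (Nat.card Empty : ℝ) = 0 * (r * L : ℕ)
    simp
  · change (Nat.card Empty : ℝ) = 0 * (r * L : ℕ)
    simp
  · refine Code.recovers_zero _ _ fun k F F' hv => ?_
    funext p
    exact congrFun (congrArg Prod.fst hv) (d k, p)

end RelayDesign

/-! ## Memory sharing -/

namespace Code

variable {H r N B B₁ B₂ : ℕ}

/-- `C` uses memories of at most `m` bits (relays) and `u` bits (users), puts at most `s` bits on
every link from the server and `f` bits on every link to a user, and every user recovers its file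
without error. -/
def Within (C : Code H r N B) (m u s f : ℝ) : Prop :=
  (∀ h, (Nat.card (C.RelayIdx h) : ℝ) ≤ m) ∧
  (∀ k, (Nat.card (C.UserIdx k) : ℝ) ≤ u) ∧
  ∀ d : Demand H r N,
    (∀ h, (Nat.card (C.TxIdx d h) : ℝ) ≤ s) ∧
    (∀ k h, (Nat.card (C.FwdIdx d k h) : ℝ) ≤ f) ∧
    C.Recovers d 0

theorem Attains.within {C : Code H r N B} {p : ℝ × ℝ × ℝ × ℝ} (hC : C.Attains p) :
    C.Within (p.1 * B) (p.2.1 * B) (p.2.2.1 * B) (p.2.2.2 * B) :=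
  ⟨fun h => (hC.1 h).le, fun k => (hC.2.1 k).le, fun d => ⟨fun h => ((hC.2.2 d).1 h).le,
    fun k h => ((hC.2.2 d).2.1 k h).le, (hC.2.2 d).2.2⟩⟩

theorem Within.mono {C : Code H r N B} {m u s f m' u' s' f' : ℝ} (hC : C.Within m u s f)
    (hm : m ≤ m') (hu : u ≤ u') (hs : s ≤ s') (hf : f ≤ f') : C.Within m' u' s' f' :=
  ⟨fun h => (hC.1 h).trans hm, fun k => (hC.2.1 k).trans hu,
    fun d => ⟨fun h => ((hC.2.2 d).1 h).trans hs, fun k h => ((hC.2.2 d).2.1 k h).trans hf,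
      (hC.2.2 d).2.2⟩⟩

/-- Use `C₁` for the first `B₁` bits of every file and `C₂` for the other `B₂` bits. -/
def append (C₁ : Code H r N B₁) (C₂ : Code H r N B₂) : Code H r N (B₁ + B₂) where
  RelayIdx h := C₁.RelayIdx h ⊕ C₂.RelayIdx h
  UserIdx k := C₁.UserIdx k ⊕ C₂.UserIdx k
  TxIdx d h := C₁.TxIdx d h ⊕ C₂.TxIdx d h
  FwdIdx d k h := C₁.FwdIdx d k h ⊕ C₂.FwdIdx d k h
  finiteRelay h := by
    have := C₁.finiteRelay h
    have := C₂.finiteRelay h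
    infer_instance
  finiteUser k := by
    have := C₁.finiteUser k
    have := C₂.finiteUser k
    infer_instance
  finiteTx d h := by
    have := C₁.finiteTx d h
    have := C₂.finiteTx d h
    infer_instance
  finiteFwd d k h := by
    have := C₁.finiteFwd d k h
    have := C₂.finiteFwd d k h
    infer_instance
  relayCache F h := Sum.elim (C₁.relayCache (fun i p => F i (Fin.castAdd B₂ p)) h)
    (C₂.relayCache (fun i p => F i (Fin.natAdd B₁ p)) h)
  userCache F k := Sum.elim (C₁.userCache (fun i p => F i (Fin.castAdd B₂ p)) k)
    (C₂.userCache (fun i p => F i (Fin.natAdd B₁ p)) k)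
  tx d F h := Sum.elim (C₁.tx d (fun i p => F i (Fin.castAdd B₂ p)) h)
    (C₂.tx d (fun i p => F i (Fin.natAdd B₁ p)) h)
  fwd d k h z x := Sum.elim (C₁.fwd d k h (z ∘ Sum.inl) (x ∘ Sum.inl))
    (C₂.fwd d k h (z ∘ Sum.inr) (x ∘ Sum.inr))

theorem append_recovers {C₁ : Code H r N B₁} {C₂ : Code H r N B₂} {d : Demand H r N}
    (h₁ : C₁.Recovers d 0) (h₂ : C₂.Recovers d 0) : (C₁.append C₂).Recovers d 0 := by
  refine recovers_zero _ _ fun k F F' hv => ?_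
  have hc := congrArg Prod.fst hv
  have hf := fun h => congrFun (congrArg Prod.snd hv) h
  have e₁ := h₁.determined (k := k) (F := fun i p => F i (Fin.castAdd B₂ p))
    (F' := fun i p => F' i (Fin.castAdd B₂ p))
    (Prod.ext (funext fun x => congrFun hc (Sum.inl x))
      (funext fun h => funext fun x => congrFun (hf h) (Sum.inl x)))
  have e₂ := h₂.determined (k := k) (F := fun i p => F i (Fin.natAdd B₁ p))
    (F' := fun i p => F' i (Fin.natAdd B₁ p))
    (Prod.ext (funext fun x => congrFun hc (Sum.inr x))
      (funext fun h => funext fun x => congrFun (hf h) (Sum.inr x)))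
  funext p
  refine Fin.addCases (fun p => ?_) (fun p => ?_) p
  · exact congrFun e₁ p
  · exact congrFun e₂ p

theorem Within.append {C₁ : Code H r N B₁} {C₂ : Code H r N B₂} {m₁ u₁ s₁ f₁ m₂ u₂ s₂ f₂ : ℝ}
    (h₁ : C₁.Within m₁ u₁ s₁ f₁) (h₂ : C₂.Within m₂ u₂ s₂ f₂) :
    (C₁.append C₂).Within (m₁ + m₂) (u₁ + u₂) (s₁ + s₂) (f₁ + f₂) := by
  have hsum : ∀ (α β : Type) [Finite α] [Finite β] (a b : ℝ), (Nat.card α : ℝ) ≤ a →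
      (Nat.card β : ℝ) ≤ b → (Nat.card (α ⊕ β) : ℝ) ≤ a + b := by
    intro α β _ _ a b ha hb
    rw [Nat.card_sum, Nat.cast_add]
    exact add_le_add ha hb
  refine ⟨fun h => ?_, fun k => ?_, fun d => ⟨fun h => ?_, fun k h => ?_,
    append_recovers (h₁.2.2 d).2.2 (h₂.2.2 d).2.2⟩⟩
  · have := C₁.finiteRelay h
    have := C₂.finiteRelay h
    exact hsum _ _ _ _ (h₁.1 h) (h₂.1 h)
  · have := C₁.finiteUser k
    have := C₂.finiteUser k
    exact hsum _ _ _ _ (h₁.2.1 k) (h₂.2.1 k)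
  · have := C₁.finiteTx d h
    have := C₂.finiteTx d h
    exact hsum _ _ _ _ ((h₁.2.2 d).1 h) ((h₂.2.2 d).1 h)
  · have := C₁.finiteFwd d k h
    have := C₂.finiteFwd d k h
    exact hsum _ _ _ _ ((h₁.2.2 d).2.1 k h) ((h₂.2.2 d).2.1 k h)

/-- Nothing is cached, the server sends the library to all relays. -/
def uncoded (H r N B : ℕ) : Code H r N B where
  RelayIdx _ := Empty
  UserIdx _ := Empty
  TxIdx _ _ := Fin N × Fin B
  FwdIdx _ _ _ := Fin B
  finiteRelay _ := inferInstance
  finiteUser _ := inferInstance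
  finiteTx _ _ := inferInstance
  finiteFwd _ _ _ := inferInstance
  relayCache _ _ := Empty.elim
  userCache _ _ := Empty.elim
  tx _ F _ x := F x.1 x.2
  fwd d k _ _ x p := x (d k, p)

theorem uncoded_within (hr : 1 ≤ r) : (uncoded H r N B).Within 0 0 (N * B) B := by
  refine ⟨fun h => ?_, fun k => ?_, fun d => ⟨fun h => ?_, fun k h => ?_, ?_⟩⟩
  · change (Nat.card Empty : ℝ) ≤ 0
    simp
  · change (Nat.card Empty : ℝ) ≤ 0
    simp
  · change (Nat.card (Fin N × Fin B) : ℝ) ≤ N * B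
    simp
  · change (Nat.card (Fin B) : ℝ) ≤ B
    simp
  · refine recovers_zero _ _ fun k F F' hv => ?_
    obtain ⟨h, hh⟩ : k.1.Nonempty := Finset.card_pos.1 (by rw [k.2]; exact hr)
    funext p
    exact congrFun (congrFun (congrArg Prod.snd hv) ⟨h, hh⟩) p

end Code

/-! ### Bounded overhead, convexity and long files -/

/-- The points that are attained for all file lengths and without error, up to a bounded number of
additional bits on every link. -/
def boundedOverhead (H r N : ℕ) : Set (ℝ × ℝ × ℝ × ℝ) :=
  {p | 0 ≤ p ∧ ∃ c : ℝ, ∀ B : ℕ, ∃ C : Code H r N B,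
    C.Within (p.1 * B) (p.2.1 * B) (p.2.2.1 * B + c) (p.2.2.2 * B + c)}

section

variable {H r N : ℕ}

/-- The exact scheme serves the largest multiple of `u` below `B`. The fewer than `u` leftover bits
of each file are sent uncoded, which uses no cache and at most `N * u` bits per link. -/
theorem mem_boundedOverhead_of_attains (hr : 1 ≤ r) (hrH : r ≤ H) (hN : 1 ≤ N)
    {p : ℝ × ℝ × ℝ × ℝ} {u : ℕ} (hu : 0 < u)
    (h : ∀ B : ℕ, 0 < B → u ∣ B → ∃ C : Code H r N B, C.Attains p) :
    p ∈ boundedOverhead H r N := by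
  -- Each coordinate times `u` is a cardinality. Nonnegativity lets the bounds grow from the
  -- multiple of `u` to `B`.
  have hp : 0 ≤ p := by
    obtain ⟨C, hC⟩ := h u hu dvd_rfl
    obtain ⟨k⟩ := exists_user hrH
    obtain ⟨x, hx⟩ : k.1.Nonempty := Finset.card_pos.1 (by rw [k.2]; exact hr)
    have hu' : (0 : ℝ) < u := by exact_mod_cast hu
    have hd := hC.2.2 fun _ => ⟨0, hN⟩
    have key : ∀ (n : ℕ) (a : ℝ), (n : ℝ) = a * u → 0 ≤ a := fun n a ha =>
      nonneg_of_mul_nonneg_left (ha ▸ Nat.cast_nonneg n) hu'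
    exact ⟨key _ _ (hC.1 x), key _ _ (hC.2.1 k), key _ _ (hd.1 x), key _ _ (hd.2.1 k ⟨x, hx⟩)⟩
  refine ⟨hp, N * u, fun B => ?_⟩
  have hN' : (1 : ℝ) ≤ N := by exact_mod_cast hN
  have hR : ∀ R : ℕ, R < u → (N * R : ℝ) ≤ N * u ∧ (R : ℝ) ≤ N * u := by
    intro R hR
    have h1 : (R : ℝ) ≤ u := by exact_mod_cast hR.le
    exact ⟨by gcongr, by nlinarith [Nat.cast_nonneg (α := ℝ) u]⟩
  obtain ⟨hp1, hp2, hp3, hp4⟩ := hp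
  simp only [Prod.fst_zero, Prod.snd_zero] at hp1 hp2 hp3 hp4
  rcases Nat.lt_or_ge B u with hB | hB
  · obtain ⟨h1, h2⟩ := hR B hB
    exact ⟨Code.uncoded H r N B, (Code.uncoded_within hr).mono (by positivity) (by positivity)
      (h1.trans (le_add_of_nonneg_left (by positivity)))
      (h2.trans (le_add_of_nonneg_left (by positivity)))⟩
  · obtain ⟨q, R, hRu, hq, rfl⟩ : ∃ q R, R < u ∧ 0 < q ∧ B = u * q + R :=
      ⟨B / u, B % u, Nat.mod_lt _ hu, Nat.div_pos hB hu, (Nat.div_add_mod B u).symm⟩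
    obtain ⟨C, hC⟩ := h (u * q) (by positivity) (Dvd.intro _ rfl)
    obtain ⟨h1, h2⟩ := hR R hRu
    have hle : ((u * q : ℕ) : ℝ) ≤ ((u * q + R : ℕ) : ℝ) := by exact_mod_cast Nat.le_add_right _ _
    refine ⟨C.append (Code.uncoded H r N R),
      (hC.within.append (Code.uncoded_within hr)).mono ?_ ?_ ?_ ?_⟩
    · rw [add_zero]
      gcongr
    · rw [add_zero]
      gcongr
    · gcongr
    · gcongr

/-- Split each file at `⌊aB⌋` and `⌊bB⌋` bits. Because the coordinates are nonnegative, rounding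
down never exceeds the memory budget. The at most two leftover bits per file are sent uncoded, and
`(N + 1) * 2` bounds their cost on both kinds of links. -/
theorem convex_boundedOverhead (hr : 1 ≤ r) : Convex ℝ (boundedOverhead H r N) := by
  rintro p ⟨hp, c₁, h₁⟩ q ⟨hq, c₂, h₂⟩ a b ha hb hab
  refine ⟨add_nonneg (smul_nonneg ha hp) (smul_nonneg hb hq), c₁ + c₂ + (N + 1) * 2, fun B => ?_⟩
  obtain ⟨hp1, hp2, hp3, hp4⟩ := hp
  obtain ⟨hq1, hq2, hq3, hq4⟩ := hq
  simp only [Prod.fst_zero, Prod.snd_zero] at hp1 hp2 hp3 hp4 hq1 hq2 hq3 hq4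
  have hf₁ : (⌊a * B⌋₊ : ℝ) ≤ a * B := Nat.floor_le (by positivity)
  have hf₂ : (⌊b * B⌋₊ : ℝ) ≤ b * B := Nat.floor_le (by positivity)
  have hg₁ : a * B < ⌊a * B⌋₊ + 1 := Nat.lt_floor_add_one _
  have hg₂ : b * B < ⌊b * B⌋₊ + 1 := Nat.lt_floor_add_one _
  have hsum : a * B + b * B = B := by rw [← add_mul, hab, one_mul]
  have hle : ⌊a * B⌋₊ + ⌊b * B⌋₊ ≤ B := by
    have : (⌊a * B⌋₊ + ⌊b * B⌋₊ : ℝ) ≤ B := by linarith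
    exact_mod_cast this
  obtain ⟨C₁, hC₁⟩ := h₁ ⌊a * B⌋₊
  obtain ⟨C₂, hC₂⟩ := h₂ ⌊b * B⌋₊
  obtain ⟨R, hR⟩ := Nat.exists_eq_add_of_le hle
  have hR2 : (R : ℝ) ≤ 2 := by
    have : (B : ℝ) = ⌊a * B⌋₊ + ⌊b * B⌋₊ + R := by exact_mod_cast hR
    linarith
  have hNR : (N * R : ℝ) ≤ N * 2 := by gcongr
  have hmix : ∀ x y : ℝ, 0 ≤ x → 0 ≤ y →
      x * ⌊a * B⌋₊ + y * ⌊b * B⌋₊ ≤ (a * x + b * y) * B := by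
    intro x y hx hy
    have h1 := mul_le_mul_of_nonneg_left hf₁ hx
    have h2 := mul_le_mul_of_nonneg_left hf₂ hy
    linarith
  have hN0 : (0 : ℝ) ≤ N := Nat.cast_nonneg N
  -- The file length is an index of the type `Code`, so the equation `hR` is used to transport only
  -- the existence statement.
  suffices h : ∃ C : Code H r N (⌊a * B⌋₊ + ⌊b * B⌋₊ + R),
      C.Within ((a * p.1 + b * q.1) * B) ((a * p.2.1 + b * q.2.1) * B)
        ((a * p.2.2.1 + b * q.2.2.1) * B + (c₁ + c₂ + (N + 1) * 2))
        ((a * p.2.2.2 + b * q.2.2.2) * B + (c₁ + c₂ + (N + 1) * 2)) by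
    rw [← hR] at h
    exact h
  refine ⟨(C₁.append C₂).append (Code.uncoded H r N R),
    ((hC₁.append hC₂).append (Code.uncoded_within hr)).mono ?_ ?_ ?_ ?_⟩
  · have := hmix _ _ hp1 hq1
    linarith
  · have := hmix _ _ hp2 hq2
    linarith
  · have := hmix _ _ hp3 hq3
    linarith
  · have := hmix _ _ hp4 hq4
    linarith

theorem achievable_of_mem_boundedOverhead {p q : ℝ × ℝ × ℝ × ℝ}
    (hq : q ∈ boundedOverhead H r N) (hqp : q ≤ p) : Achievable H r N p := by
  obtain ⟨-, c, hc⟩ := hq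
  obtain ⟨h1, h2, h3, h4⟩ := hqp
  intro ε hε
  -- From this length on, the constant overhead `c` is at most `ε * B`.
  refine ⟨⌈c / ε⌉₊, fun B hB => ?_⟩
  have hcB : c ≤ ε * B := by
    rw [mul_comm, ← div_le_iff₀ hε]
    exact (Nat.le_ceil _).trans (by exact_mod_cast hB)
  obtain ⟨C, hC⟩ := hc B
  have hC' := hC.mono (m' := p.1 * B) (u' := p.2.1 * B) (s' := (p.2.2.1 + ε) * B)
    (f' := (p.2.2.2 + ε) * B) (by gcongr) (by gcongr)
    (by rw [add_mul]; gcongr) (by rw [add_mul]; gcongr)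
  refine ⟨C, hC'.1, hC'.2.1, fun d => ⟨(hC'.2.2 d).1, (hC'.2.2 d).2.1, ?_⟩⟩
  obtain ⟨dec, hdec⟩ := (hC'.2.2 d).2.2
  refine ⟨dec, hdec.trans ?_⟩
  rw [zero_mul]
  positivity

theorem cornerPoints_subset_boundedOverhead (hr : 1 ≤ r) (hrH : r ≤ H) (hN : 1 ≤ N) :
    cornerPoints H r N ⊆ boundedOverhead H r N := by
  have hrelay := RelayDesign.exists_relayDesigns hrH hr
  rintro p ((⟨g, hg, hgK, rfl⟩ | ⟨g, hg, hgK, rfl⟩) | rfl | rfl)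
  · obtain ⟨b, hb, hD⟩ := exists_endUser_designs hrH hg
    have hS : 0 < (S₁ H r g).toNat := by
      have := S₁_pos hr hrH hg (by omega)
      omega
    refine mem_boundedOverhead_of_attains hr hrH hN (Nat.mul_pos hS hb) fun B hB hdvd => ?_
    obtain ⟨n, rfl⟩ := hdvd
    obtain ⟨D⟩ := hD n (Nat.pos_of_mul_pos_left hB)
    rw [show (S₁ H r g).toNat * b * n = (S₁ H r g).toNat * (n * b) by ring]
    exact ⟨_, D.attains_endUserPoint hr hrH hN hg hgK⟩
  · obtain ⟨b, hb, hD⟩ := exists_relayUser_designs hr hrH hg hgK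
    have hgK' : (g : ℤ) - 1 ≤ numUsers H r 1 := by
      have := numUsers_two_le hr hrH
      omega
    have hS : 0 < (S₁ H r g).toNat := by
      have := S₁_pos hr hrH (by omega : 1 ≤ g) hgK'
      omega
    refine mem_boundedOverhead_of_attains hr hrH hN
      (Nat.mul_pos hS (Nat.mul_pos (yStar_pos hr hrH hg hgK') hb)) fun B hB hdvd => ?_
    obtain ⟨n, rfl⟩ := hdvd
    obtain ⟨D⟩ := hD n (Nat.pos_of_mul_pos_left hB)
    rw [show (S₁ H r g).toNat * (yStar H r g * b) * n =
      (S₁ H r g).toNat * (yStar H r g * (n * b)) by ring]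
    exact ⟨_, D.attains_relayUserPoint hr hrH hN hg hgK⟩
  · obtain ⟨b, hb, hD⟩ := hrelay
    refine mem_boundedOverhead_of_attains hr hrH hN (Nat.mul_pos hr hb) fun B hB hdvd => ?_
    obtain ⟨n, rfl⟩ := hdvd
    obtain ⟨D⟩ := hD n (Nat.pos_of_mul_pos_left hB)
    rw [show r * b * n = r * (n * b) by ring]
    exact ⟨_, D.attains_relayPoint hr⟩
  · obtain ⟨b, hb, hD⟩ := hrelay
    refine mem_boundedOverhead_of_attains hr hrH hN (Nat.mul_pos hr hb) fun B hB hdvd => ?_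
    obtain ⟨n, rfl⟩ := hdvd
    obtain ⟨D⟩ := hD n (Nat.pos_of_mul_pos_left hB)
    rw [show r * b * n = r * (n * b) by ring]
    exact ⟨_, D.attains_fullPoint hr⟩

end

end CombNet

theorem mainTheorem2 (H r N : ℕ) (hr : 1 ≤ r) (hrH : r ≤ H) (hN : 1 ≤ N) :
    -- first group: end-user caches only
    (∀ g : ℕ, 1 ≤ g → (g : ℤ) ≤ CombNet.numUsers H r 1 →
      (∃ b : ℕ, 0 < b ∧ ∀ n : ℕ, 0 < n → Nonempty (CombNet.Design H r g (n * b) 0)) ∧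
      ∀ (L : ℕ) (D : CombNet.Design H r g L 0),
        (D.code N).Attains (CombNet.endUserPoint H r N g)) ∧
    -- second group: cache-aided relays and users
    (∀ g : ℕ, 2 ≤ g → (g : ℤ) ≤ CombNet.numUsers H r 2 + 1 →
      (∃ b : ℕ, 0 < b ∧ ∀ n : ℕ, 0 < n →
        Nonempty (CombNet.Design H r g (CombNet.yStar H r g * (n * b)) (n * b))) ∧
      ∀ (c : ℕ) (D : CombNet.Design H r g (CombNet.yStar H r g * c) c),
        (D.code N).Attains (CombNet.relayUserPoint H r N g)) ∧
    -- third group: each relay caches an MDS symbol of every file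
    ((∃ b : ℕ, 0 < b ∧ ∀ n : ℕ, 0 < n → Nonempty (CombNet.RelayDesign H r (n * b))) ∧
      ∀ (L : ℕ) (D : CombNet.RelayDesign H r L),
        (D.code N).Attains (CombNet.relayPoint r N) ∧
        (D.fullCode N).Attains (CombNet.fullPoint r N)) ∧
    -- memory sharing: everything on or above the lower convex envelope is achievable
    (∀ p ∈ (upperClosure (convexHull ℝ (CombNet.cornerPoints H r N)) :
        UpperSet (ℝ × ℝ × ℝ × ℝ)), CombNet.Achievable H r N p) := by
  refine ⟨fun g hg hgK => ⟨CombNet.exists_endUser_designs hrH hg,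
      fun L D => D.attains_endUserPoint hr hrH hN hg hgK⟩,
    fun g hg hgK => ⟨CombNet.exists_relayUser_designs hr hrH hg hgK,
      fun c D => D.attains_relayUserPoint hr hrH hN hg hgK⟩,
    ⟨CombNet.RelayDesign.exists_relayDesigns hrH hr,
      fun L D => ⟨D.attains_relayPoint hr, D.attains_fullPoint hr⟩⟩, fun p hp => ?_⟩
  obtain ⟨q, hq, hqp⟩ := mem_upperClosure.1 hp
  exact CombNet.achievable_of_mem_boundedOverhead
    (convexHull_min (CombNet.cornerPoints_subset_boundedOverhead hr hrH hN)
      (CombNet.convex_boundedOverhead hr) hq) hqp
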